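/- Work on $\mathbb R^3$ with complex-valued functions, and let $\beta>0$ and $$E(u,v)=\tfrac12\int(|\nabla u|^2+|\nabla v|^2)\,dx-\tfrac14\int(|u|^4+2\beta|uv|^2+|v|^4)\,dx,\qquad u,v\in H^1(\mathbb R^3).$$ Fix $3<r_0<6$ and put $\|U\|_{S(\dot H^{1/2})}=\sup\{\|U\|_{L^q_tL^r_x}:\ \tfrac2q+\tfrac3r=1,\ 3\le r\le r_0\}$. Let $(\phi_n)$ and $(\widetilde\phi_n)$ be bounded sequences in $H^1(\mathbb R^3)$ with a profile decomposition with common shifts, that is: there are profiles $\psi^j,\widetilde\psi^j\in H^1$ ($j\ge1$), time shifts $t_n^j\in\mathbb R$, space shifts $x_n^j\in\mathbb R^3$, and remainders $W_n^M,\widetilde W_n^M\in H^1$ such that, for all $M\ge1$ and all $n$, $$(\phi_n,\widetilde\phi_n)=\sum_{j=1}^M\big(e^{-it_n^j\Delta}\psi^j(\cdot-x_n^j),\,e^{-it_n^j\Delta}\widetilde\psi^j(\cdot-x_n^j)\big)+(W_n^M,\widetilde W_n^M),$$ $$\lim_{n\to\infty}\big(|t_n^j-t_n^k|+|x_n^j-x_n^k|\big)=\infty\quad\text{for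 all } j\neq k,$$ $$\lim_{M\to\infty}\limsup_{n\to\infty}\big(\|e^{it\Delta}W_n^M\|_{S(\dot H^{1/2})}+\|e^{it\Delta}\widetilde W_n^M\|_{S(\dot H^{1/2})}\big)=0.$$ Then, for each $M\ge1$, as $n\to\infty$, $$E(\phi_n,\widetilde\phi_n)=\sum_{j=1}^M E\big(e^{-it_n^j\Delta}\psi^j(\cdot-x_n^j),\,e^{-it_n^j\Delta}\widetilde\psi^j(\cdot-x_n^j)\big)+E(W_n^M,\widetilde W_n^M)+o_n(1),$$ and $$\|\phi_n\widetilde\phi_n\|_{L^2}^2=\sum_{j=1}^M\big\|e^{-it_n^j\Delta}\psi^j(\cdot-x_n^j)\;e^{-it_n^j\Delta}\widetilde\psi^j(\cdot-x_n^j)\big\|_{L^2}^2+\|W_n^M\widetilde W_n^M\|_{L^2}^2+o_n(1).$$ -/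

import Mathlib

open MeasureTheory Filter Topology
open scoped ENNReal FourierTransform LineDeriv SchwartzMap

noncomputable section

namespace NLSSystem

/-- Three-dimensional Euclidean space. -/
abbrev E3 : Type := EuclideanSpace ℝ (Fin 3)

/-- The space `L²(ℝ³; ℂ)`. -/
abbrev L2 : Type := Lp ℂ 2 (volume : Measure E3)

/-- The tempered distribution defined by an `L²` function. -/
def toDistr (u : L2) : 𝓢'(E3, ℂ) := (u : 𝓢'(E3, ℂ))

/-- `u ∈ H¹(ℝ³)`. -/
def IsH1 (u : L2) : Prop := TemperedDistribution.MemSobolev 1 2 (toDistr u)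

/-- The function `v ∈ L²` is the distributional partial derivative `∂ₖ u`. -/
def IsWeakPartial (k : Fin 3) (u v : L2) : Prop :=
  toDistr v = ∂_{(EuclideanSpace.single k (1 : ℝ) : E3)} (toDistr u)

open Classical in
/-- The distributional partial derivative `∂ₖ u` as an element of `L²`
(with value `0` if it is not in `L²`; it is in `L²` for every `u ∈ H¹`,
see `isWeakPartial_weakPartial`). -/
def weakPartial (k : Fin 3) (u : L2) : L2 :=
  if h : ∃ v : L2, IsWeakPartial k u v then h.choose else 0

theorem isWeakPartial_weakPartial {u : L2} (hu : IsH1 u) (k : Fin 3) :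
    IsWeakPartial k u (weakPartial k u) := by
  have h : ∃ v : L2, IsWeakPartial k u v := by
    have h1 := hu.lineDerivOp (m := (EuclideanSpace.single k (1 : ℝ) : E3))
    rw [sub_self, TemperedDistribution.memSobolev_zero_iff] at h1
    obtain ⟨v, hv⟩ := h1
    exact ⟨v, hv.symm⟩
  unfold weakPartial
  rw [dif_pos h]
  exact h.choose_spec

theorem IsWeakPartial.unique {k : Fin 3} {u v w : L2} (hv : IsWeakPartial k u v)
    (hw : IsWeakPartial k u w) : v = w := by
  have h : toDistr v = toDistr w := hv.trans hw.symm
  have hinj := LinearMap.ker_eq_bot.mp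
    (Lp.ker_toTemperedDistributionCLM_eq_bot (F := ℂ) (E := E3) (p := 2) (μ := volume))
  exact hinj h

/-- `|∇u(x)|² = ∑ₖ |∂ₖ u(x)|²`. -/
def gradSq (u : L2) (x : E3) : ℝ := ∑ k, ‖weakPartial k u x‖ ^ 2

/-- The norm `(‖u‖²_{L²} + ‖∇u‖²_{L²})^{1/2}` of `H¹(ℝ³)`. -/
def h1Norm (u : L2) : ℝ := Real.sqrt (‖u‖ ^ 2 + ∑ k, ‖weakPartial k u‖ ^ 2)

/-- The energy
`E(u,v) = ½ ∫ (|∇u|² + |∇v|²) - ¼ ∫ (|u|⁴ + 2β|uv|² + |v|⁴)`. -/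
def energy (β : ℝ) (u v : L2) : ℝ :=
  (1 / 2) * (∫ x : E3, (gradSq u x + gradSq v x)) -
    (1 / 4) * ∫ x : E3, (‖u x‖ ^ 4 + 2 * β * ‖u x * v x‖ ^ 2 + ‖v x‖ ^ 4)

/-- The symbol of `e^{itΔ}`. The Fourier transform in use is `∫ e^{-2πi x·ξ} f(x) dx`, so `Δ` has
the symbol `-4π²|ξ|²`. -/
def schrodingerSymbol (t : ℝ) (ξ : E3) : ℂ :=
  Complex.exp (((-(4 * Real.pi ^ 2 * t * ‖ξ‖ ^ 2) : ℝ) : ℂ) * Complex.I)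

theorem memLp_schrodingerSymbol_mul (t : ℝ) (f : L2) :
    MemLp (fun ξ : E3 => schrodingerSymbol t ξ * f ξ) 2 volume := by
  have hc : Continuous (schrodingerSymbol t) := by
    unfold schrodingerSymbol
    fun_prop
  refine (Lp.memLp f).of_le (hc.aestronglyMeasurable.mul (Lp.aestronglyMeasurable f)) ?_
  refine Eventually.of_forall fun ξ => ?_
  rw [norm_mul, schrodingerSymbol, Complex.norm_exp_ofReal_mul_I, one_mul]

/-- The free Schrödinger group `e^{itΔ}` on `L²(ℝ³)`. -/
def schrodinger (t : ℝ) (u : L2) : L2 :=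
  𝓕⁻ ((memLp_schrodingerSymbol_mul t (𝓕 u)).toLp _)

/-- The translate `u(· - y)`. -/
def translate (y : E3) (u : L2) : L2 :=
  Lp.compMeasurePreserving (fun x : E3 => x - y) (measurePreserving_sub_right volume y) u

/-- The linearly evolved, translated profile `e^{-itΔ}ψ(· - y)`. -/
def profileWave (t : ℝ) (y : E3) (ψ : L2) : L2 := translate y (schrodinger (-t) ψ)

/-- The mixed norm `‖U‖_{L^q_t L^r_x}` over `ℝ × ℝ³`. -/
def mixedNorm (q r : ℝ≥0∞) (U : ℝ → L2) : ℝ≥0∞ :=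
  eLpNorm (fun t : ℝ => eLpNorm (U t) r (volume : Measure E3)) q (volume : Measure ℝ)

/-- The norm of `S(Ḣ^{1/2})`: the supremum of the mixed norms over all pairs `(q, r)` with
`2/q + 3/r = 1` and `3 ≤ r ≤ r₀`. Here `r₀ < 6` is the preselected number that is usually written
`6⁻`; the relation between `q` and `r` turns `r ≤ r₀` into a lower bound `q ≥ q₀ > 4`. -/
def strichartzNorm (r₀ : ℝ≥0∞) (U : ℝ → L2) : ℝ≥0∞ :=
  ⨆ (q : ℝ≥0∞) (r : ℝ≥0∞) (_ : 2 / q + 3 / r = 1 ∧ 3 ≤ r ∧ r ≤ r₀), mixedNorm q r U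

/-- The sequence `φ` is bounded in `H¹(ℝ³)`. -/
def BoundedInH1 (φ : ℕ → L2) : Prop := ∃ C : ℝ, ∀ n, IsH1 (φ n) ∧ h1Norm (φ n) ≤ C

/-- A profile decomposition of a pair of sequences `φ`, `φ'` that are bounded in `H¹(ℝ³)`, with
common time shifts `t j n` and space shifts `x j n`. The profiles `ψ j`, `ψ' j` are numbered from
`j = 0`, so that the first `M` of them are those with `j < M`; `W M n` and `W' M n` are the
remainders after `M` profiles. -/
structure IsProfileDecomposition (r₀ : ℝ≥0∞) (φ φ' : ℕ → L2) (ψ ψ' : ℕ → L2)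
    (t : ℕ → ℕ → ℝ) (x : ℕ → ℕ → E3) (W W' : ℕ → ℕ → L2) : Prop where
  bounded : BoundedInH1 φ
  bounded' : BoundedInH1 φ'
  profile_mem : ∀ j, IsH1 (ψ j)
  profile_mem' : ∀ j, IsH1 (ψ' j)
  remainder_mem : ∀ M, 1 ≤ M → ∀ n, IsH1 (W M n)
  remainder_mem' : ∀ M, 1 ≤ M → ∀ n, IsH1 (W' M n)
  decomposition : ∀ M, 1 ≤ M → ∀ n,
    φ n = ∑ j ∈ Finset.range M, profileWave (t j n) (x j n) (ψ j) + W M n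
  decomposition' : ∀ M, 1 ≤ M → ∀ n,
    φ' n = ∑ j ∈ Finset.range M, profileWave (t j n) (x j n) (ψ' j) + W' M n
  orthogonality : ∀ j k, j ≠ k →
    Tendsto (fun n => |t j n - t k n| + ‖x j n - x k n‖) atTop atTop
  vanishing : Tendsto (fun M => limsup (fun n =>
      strichartzNorm r₀ (fun s => schrodinger s (W M n)) +
        strichartzNorm r₀ (fun s => schrodinger s (W' M n))) atTop) atTop (𝓝 0)

end NLSSystem

end

/-! Write G_n^j for the unitary operator that evolves by time -t_n^j and translates by x_n^j. Two
orthogonality mechanisms give the decoupling, one for the kinetic part and one for the quartic part.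

Kinetic part. By Pythagoras in L² it suffices that the cross inner products of gradients vanish. The
G_n^j commute with derivatives, so for two profiles this says that (G_n^j)⁻¹ G_n^k ψ^k tends weakly
to zero. If the time gap diverges, this is the L⁴ decay of the free evolution; if it stays bounded
along a subsequence, the space gap diverges and Riemann-Lebesgue applies. For the remainder,
(G_n^j)⁻¹ W_n^M with j < M is expanded into the profiles from M to N and W_n^N. The profiles are
handled as before, and W_n^N is small in L³ at every time, because (∞, 3) is one of the pairs in the
Strichartz norm (`eLpNorm_three_evolve_le`).

Quartic part. Since |u|⁴ = |u·u|², every quartic integral is the squared norm of a value of the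
product map `mulL4` from L⁴ × L⁴ to L². Products of pieces with different indices tend to zero in
L²: one factor disperses, or the two separate in space (`tendsto_mulL4_evolve`). The inequality
|⟨ab, cd⟩| ≤ ‖ad‖ ‖cb‖ then makes the diagonal products asymptotically orthogonal. Kinetic
decoupling bounds the gradients of the remainders uniformly in M, hence so are their L⁶ norms;
interpolation with the small L³ norm makes them small in L⁴. A late remainder can therefore be
discarded, which reduces the claim to finite sums of profiles
(`tendsto_norm_sq_bilinear_decomposition`). -/

noncomputable section

namespace NLSSystem

/-! ### Fourier multipliers of modulus one -/

/-- The Fourier symbol of `translate y ∘ schrodinger t`. -/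
def phase (t : ℝ) (y ξ : E3) : ℂ :=
  Complex.exp (((-(4 * Real.pi ^ 2 * t * ‖ξ‖ ^ 2 + 2 * Real.pi * inner ℝ y ξ) : ℝ) : ℂ) *
    Complex.I)

theorem norm_phase (t : ℝ) (y ξ : E3) : ‖phase t y ξ‖ = 1 := by
  rw [phase, Complex.norm_exp_ofReal_mul_I]

theorem continuous_phase (t : ℝ) (y : E3) : Continuous (phase t y) := by
  unfold phase
  fun_prop

theorem phase_add (s t : ℝ) (z y ξ : E3) :
    phase (s + t) (z + y) ξ = phase s z ξ * phase t y ξ := by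
  simp only [phase, ← Complex.exp_add, ← add_mul, ← Complex.ofReal_add, inner_add_left]
  congr 3
  ring

theorem phase_zero (ξ : E3) : phase 0 0 ξ = 1 := by
  simp [phase]

theorem memLp_phase_mul (t : ℝ) (y : E3) (f : L2) :
    MemLp (fun ξ : E3 => phase t y ξ * f ξ) 2 volume := by
  refine (Lp.memLp f).of_le
    ((continuous_phase t y).aestronglyMeasurable.mul (Lp.aestronglyMeasurable f)) ?_
  refine Eventually.of_forall fun ξ => ?_
  rw [norm_mul, norm_phase, one_mul]

/-- Multiplication by `phase t y` as an isometry of `L²`. -/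
def phaseMul (t : ℝ) (y : E3) : L2 →ₗᵢ[ℂ] L2 where
  toFun f := (memLp_phase_mul t y f).toLp _
  map_add' f g := by
    ext1
    filter_upwards [(memLp_phase_mul t y (f + g)).coeFn_toLp, (memLp_phase_mul t y f).coeFn_toLp,
      (memLp_phase_mul t y g).coeFn_toLp, Lp.coeFn_add f g,
      Lp.coeFn_add ((memLp_phase_mul t y f).toLp _) ((memLp_phase_mul t y g).toLp _)]
      with ξ h1 h2 h3 h4 h5
    rw [h1, h5, Pi.add_apply, h2, h3, h4, Pi.add_apply, mul_add]
  map_smul' c f := by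
    ext1
    filter_upwards [(memLp_phase_mul t y (c • f)).coeFn_toLp,
      (memLp_phase_mul t y f).coeFn_toLp, Lp.coeFn_smul c f,
      Lp.coeFn_smul c ((memLp_phase_mul t y f).toLp _)] with ξ h1 h2 h3 h4
    simp only [RingHom.id_apply]
    rw [h1, h4, Pi.smul_apply, h2, h3, Pi.smul_apply, smul_eq_mul, smul_eq_mul]
    ring
  norm_map' f := by
    change ‖(memLp_phase_mul t y f).toLp _‖ = ‖f‖
    rw [Lp.norm_toLp, Lp.norm_def]
    congr 1
    refine eLpNorm_congr_norm_ae (Eventually.of_forall fun ξ => ?_)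
    rw [norm_mul, norm_phase, one_mul]

theorem coeFn_phaseMul (t : ℝ) (y : E3) (f : L2) :
    phaseMul t y f =ᵐ[volume] fun ξ => phase t y ξ * f ξ :=
  (memLp_phase_mul t y f).coeFn_toLp

theorem translate_toLp (y : E3) (f : 𝓢(E3, ℂ)) :
    translate y (f.toLp 2) = (SchwartzMap.compSubConstCLM ℂ y f).toLp 2 := by
  rw [translate, SchwartzMap.toLp, Lp.toLp_compMeasurePreserving, SchwartzMap.toLp]
  congr 1

theorem fourier_compSubConst (y : E3) (f : 𝓢(E3, ℂ)) (ξ : E3) :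
    𝓕 (SchwartzMap.compSubConstCLM ℂ y f) ξ = phase 0 y ξ * 𝓕 f ξ := by
  have h := congrFun (VectorFourier.fourierIntegral_comp_add_right Real.fourierChar
    (volume : Measure E3) (innerₗ E3) f (-y)) ξ
  have e1 : 𝓕 (SchwartzMap.compSubConstCLM ℂ y f) ξ =
      VectorFourier.fourierIntegral Real.fourierChar volume (innerₗ E3) (⇑f ∘ fun v => v + -y) ξ := by
    rw [SchwartzMap.fourier_coe]
    rfl
  rw [e1, h, SchwartzMap.fourier_coe]
  change _ • _ = phase 0 y ξ * VectorFourier.fourierIntegral Real.fourierChar volume (innerₗ E3) f ξ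
  rw [Circle.smul_def, smul_eq_mul, Real.fourierChar_apply, phase]
  congr 3
  simp

/-- Both sides are continuous in `u`, so it suffices to compute on Schwartz functions, where the
Fourier integral is available pointwise. -/
theorem fourier_translate (y : E3) (u : L2) : 𝓕 (translate y u) = phaseMul 0 y (𝓕 u) := by
  have hd := SchwartzMap.denseRange_toLpCLM (E := E3) (F := ℂ) (p := 2) (μ := volume)
    ENNReal.ofNat_ne_top
  refine hd.induction_on (p := fun u : L2 => 𝓕 (translate y u) = phaseMul 0 y (𝓕 u)) u ?_ ?_
  · refine isClosed_eq ?_ ?_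
    · exact ((Lp.fourierTransformₗᵢ E3 ℂ).continuous).comp
        (Lp.isometry_compMeasurePreserving (measurePreserving_sub_right volume y)).continuous
    · exact (phaseMul 0 y).continuous.comp (Lp.fourierTransformₗᵢ E3 ℂ).continuous
  · intro f
    rw [SchwartzMap.toLpCLM_apply, translate_toLp, SchwartzMap.toLp_fourier_eq,
      SchwartzMap.toLp_fourier_eq]
    ext1
    filter_upwards [coeFn_phaseMul 0 y ((𝓕 f).toLp 2), (𝓕 f).coeFn_toLp 2 volume,
      (𝓕 (SchwartzMap.compSubConstCLM ℂ y f)).coeFn_toLp 2 volume] with ξ h1 h2 h3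
    rw [h1, h2, h3, fourier_compSubConst]

/-- The operator `translate y ∘ schrodinger t`, a linear isometry of `L²`. -/
def evolve (t : ℝ) (y : E3) : L2 →ₗᵢ[ℂ] L2 :=
  (Lp.fourierTransformₗᵢ E3 ℂ).symm.toLinearIsometry.comp
    ((phaseMul t y).comp (Lp.fourierTransformₗᵢ E3 ℂ).toLinearIsometry)

theorem fourier_evolve (t : ℝ) (y : E3) (u : L2) : 𝓕 (evolve t y u) = phaseMul t y (𝓕 u) :=
  (Lp.fourierTransformₗᵢ E3 ℂ).apply_symm_apply _

theorem fourier_injective {u v : L2} (h : 𝓕 u = 𝓕 v) : u = v :=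
  (Lp.fourierTransformₗᵢ E3 ℂ).injective h

theorem fourier_schrodinger (t : ℝ) (u : L2) : 𝓕 (schrodinger t u) = phaseMul t 0 (𝓕 u) := by
  rw [schrodinger, FourierTransform.fourier_fourierInv_eq]
  ext1
  filter_upwards [coeFn_phaseMul t 0 (𝓕 u), (memLp_schrodingerSymbol_mul t (𝓕 u)).coeFn_toLp]
    with ξ h1 h2
  rw [h1, h2, phase, schrodingerSymbol]
  simp

theorem phaseMul_phaseMul (s t : ℝ) (z y : E3) (f : L2) :
    phaseMul s z (phaseMul t y f) = phaseMul (s + t) (z + y) f := by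
  ext1
  filter_upwards [coeFn_phaseMul s z (phaseMul t y f), coeFn_phaseMul t y f,
    coeFn_phaseMul (s + t) (z + y) f] with ξ h1 h2 h3
  rw [h1, h2, h3, phase_add, mul_assoc]

/-- The symbols multiply, so the operators represent the additive group of pairs (time, shift). All
later cancellations of one profile's parameters against another's use this law. -/
theorem evolve_evolve (s t : ℝ) (z y : E3) (u : L2) :
    evolve s z (evolve t y u) = evolve (s + t) (z + y) u := by
  apply fourier_injective
  rw [fourier_evolve, fourier_evolve, fourier_evolve, phaseMul_phaseMul]

theorem evolve_zero (u : L2) : evolve 0 0 u = u := by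
  apply fourier_injective
  rw [fourier_evolve]
  ext1
  filter_upwards [coeFn_phaseMul 0 0 (𝓕 u)] with ξ h1
  rw [h1, phase_zero, one_mul]

theorem schrodinger_eq_evolve (t : ℝ) (u : L2) : schrodinger t u = evolve t 0 u := by
  apply fourier_injective
  rw [fourier_schrodinger, fourier_evolve]

theorem translate_eq_evolve (y : E3) (u : L2) : translate y u = evolve 0 y u := by
  apply fourier_injective
  rw [fourier_translate, fourier_evolve]

theorem profileWave_eq_evolve (t : ℝ) (y : E3) (u : L2) :
    profileWave t y u = evolve (-t) y u := by
  rw [profileWave, translate_eq_evolve, schrodinger_eq_evolve, evolve_evolve, zero_add, add_zero]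

theorem evolve_eq_translate (t : ℝ) (y : E3) (u : L2) :
    evolve t y u = translate y (evolve t 0 u) := by
  rw [translate_eq_evolve, evolve_evolve, zero_add, add_zero]

theorem inner_evolve_right (t : ℝ) (y : E3) (u v : L2) :
    inner ℂ u (evolve t y v) = inner ℂ (evolve (-t) (-y) u) v := by
  rw [← (evolve t y).inner_map_map (evolve (-t) (-y) u) v, evolve_evolve, add_neg_cancel,
    add_neg_cancel, evolve_zero]

/-! ### Weak partial derivatives on the Fourier side -/

/-- Fourier transform of tempered distributions turns the derivative into multiplication by 2πiξ_k.
Both sides are then locally integrable functions, and these agree almost everywhere once they agree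
against test functions. -/
theorem isWeakPartial_iff {k : Fin 3} {u v : L2} :
    IsWeakPartial k u v ↔ (𝓕 v : L2) =ᵐ[volume] fun ξ => (2 * Real.pi * Complex.I) * ((ξ k : ℂ) * (𝓕 u : L2) ξ) := by
  have htg : Function.HasTemperateGrowth
      (fun ξ : E3 => ((inner ℝ ξ (EuclideanSpace.single k (1 : ℝ)) : ℝ) : ℂ)) := by fun_prop
  have key : IsWeakPartial k u v ↔ ∀ f : 𝓢(E3, ℂ), ∫ ξ, f ξ • (𝓕 v : L2) ξ =
      ∫ ξ, f ξ • ((2 * Real.pi * Complex.I) * ((ξ k : ℂ) * (𝓕 u : L2) ξ)) := by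
    have h1 : IsWeakPartial k u v ↔ 𝓕 (toDistr v) =
        𝓕 (∂_{(EuclideanSpace.single k (1 : ℝ) : E3)} (toDistr u)) :=
      ⟨fun h => congrArg _ h, fun h => by
        have := congrArg (fun w : 𝓢'(E3, ℂ) => 𝓕⁻ w) h
        simp only [FourierTransform.fourierInv_fourier_eq] at this
        exact this⟩
    rw [h1, TemperedDistribution.fourier_lineDerivOp_eq, toDistr, toDistr,
      Lp.fourier_toTemperedDistribution_eq, Lp.fourier_toTemperedDistribution_eq]
    rw [DFunLike.ext_iff]
    refine forall_congr' fun f => ?_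
    rw [Lp.toTemperedDistribution_apply, smul_apply,
      TemperedDistribution.smulLeftCLM_apply_apply, Lp.toTemperedDistribution_apply]
    rw [← integral_smul]
    refine Eq.congr_right (integral_congr_ae (Eventually.of_forall fun ξ => ?_))
    simp only [SchwartzMap.smulLeftCLM_apply_apply htg, smul_eq_mul]
    rw [EuclideanSpace.inner_single_right]
    simp
    ring
  rw [key]
  constructor
  · intro h
    refine ae_eq_of_integral_contDiff_smul_eq ?_ ?_ ?_
    · exact (Lp.memLp _).locallyIntegrable one_le_two
    · refine (((Lp.memLp (𝓕 u : L2)).locallyIntegrable one_le_two).continuous_mul (g := fun ξ : E3 => (ξ k : ℂ)) (by fun_prop)).continuous_mul (g := fun _ => 2 * Real.pi * Complex.I) (by fun_prop)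
    · intro g hg hg'
      have := h (HasCompactSupport.toSchwartzMap (f := fun x => (g x : ℂ))
        (hg'.comp_left Complex.ofReal_zero) (Complex.ofRealCLM.contDiff.comp hg))
      simp only [Complex.real_smul]
      exact this
  · intro h f
    refine integral_congr_ae ?_
    filter_upwards [h] with ξ hξ
    rw [hξ]

theorem IsWeakPartial.add {k : Fin 3} {u u' v v' : L2} (h : IsWeakPartial k u v)
    (h' : IsWeakPartial k u' v') : IsWeakPartial k (u + u') (v + v') := by
  rw [isWeakPartial_iff] at *
  rw [FourierTransform.fourier_add, FourierTransform.fourier_add]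
  filter_upwards [h, h', Lp.coeFn_add (𝓕 u : L2) (𝓕 u'), Lp.coeFn_add (𝓕 v : L2) (𝓕 v')]
    with ξ h1 h2 h3 h4
  rw [h4, h3, Pi.add_apply, Pi.add_apply, h1, h2]
  ring

theorem IsWeakPartial.smul {k : Fin 3} {u v : L2} (c : ℂ) (h : IsWeakPartial k u v) :
    IsWeakPartial k (c • u) (c • v) := by
  rw [isWeakPartial_iff] at *
  rw [FourierTransform.fourier_smul, FourierTransform.fourier_smul]
  filter_upwards [h, Lp.coeFn_smul c (𝓕 u : L2), Lp.coeFn_smul c (𝓕 v : L2)] with ξ h1 h2 h3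
  rw [h3, h2, Pi.smul_apply, Pi.smul_apply, h1, smul_eq_mul, smul_eq_mul]
  ring

theorem IsWeakPartial.sub {k : Fin 3} {u u' v v' : L2} (h : IsWeakPartial k u v)
    (h' : IsWeakPartial k u' v') : IsWeakPartial k (u - u') (v - v') := by
  have := h.add (h'.smul (-1))
  simpa only [neg_smul, one_smul, ← sub_eq_add_neg] using this

theorem IsWeakPartial.evolve {k : Fin 3} {u v : L2} (h : IsWeakPartial k u v) (t : ℝ) (y : E3) :
    IsWeakPartial k (evolve t y u) (evolve t y v) := by
  rw [isWeakPartial_iff] at *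
  rw [fourier_evolve, fourier_evolve]
  filter_upwards [h, coeFn_phaseMul t y (𝓕 u), coeFn_phaseMul t y (𝓕 v)] with ξ h1 h2 h3
  rw [h3, h2, h1]
  ring

/-- All first-order distributional derivatives of `u` are in `L²`. -/
def WeaklyDiff (u : L2) : Prop := ∀ k, IsWeakPartial k u (weakPartial k u)

theorem IsH1.weaklyDiff {u : L2} (hu : IsH1 u) : WeaklyDiff u := isWeakPartial_weakPartial hu

theorem IsWeakPartial.weakPartial_eq {k : Fin 3} {u v : L2} (h : IsWeakPartial k u v) :
    weakPartial k u = v := by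
  have hex : ∃ v : L2, IsWeakPartial k u v := ⟨v, h⟩
  refine IsWeakPartial.unique ?_ h
  unfold weakPartial
  rw [dif_pos hex]
  exact hex.choose_spec

theorem weaklyDiff_of_forall_exists {u : L2} (h : ∀ k, ∃ v, IsWeakPartial k u v) :
    WeaklyDiff u := fun k => by
  obtain ⟨v, hv⟩ := h k
  rwa [hv.weakPartial_eq]

theorem WeaklyDiff.add {u v : L2} (hu : WeaklyDiff u) (hv : WeaklyDiff v) : WeaklyDiff (u + v) :=
  weaklyDiff_of_forall_exists fun k => ⟨_, (hu k).add (hv k)⟩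

theorem WeaklyDiff.sub {u v : L2} (hu : WeaklyDiff u) (hv : WeaklyDiff v) : WeaklyDiff (u - v) :=
  weaklyDiff_of_forall_exists fun k => ⟨_, (hu k).sub (hv k)⟩

theorem WeaklyDiff.evolve {u : L2} (hu : WeaklyDiff u) (t : ℝ) (y : E3) :
    WeaklyDiff (evolve t y u) :=
  weaklyDiff_of_forall_exists fun k => ⟨_, (hu k).evolve t y⟩

theorem WeaklyDiff.weakPartial_sub {u v : L2} (hu : WeaklyDiff u) (hv : WeaklyDiff v)
    (k : Fin 3) : weakPartial k (u - v) = weakPartial k u - weakPartial k v :=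
  ((hu k).sub (hv k)).weakPartial_eq

theorem WeaklyDiff.weakPartial_evolve {u : L2} (hu : WeaklyDiff u) (t : ℝ) (y : E3) (k : Fin 3) :
    weakPartial k (NLSSystem.evolve t y u) = NLSSystem.evolve t y (weakPartial k u) :=
  ((hu k).evolve t y).weakPartial_eq

theorem isWeakPartial_zero (k : Fin 3) : IsWeakPartial k 0 0 := by
  have h0 : (𝓕 (0 : L2) : L2) = 0 := (Lp.fourierTransformₗᵢ E3 ℂ).map_zero
  rw [isWeakPartial_iff, h0]
  filter_upwards [Lp.coeFn_zero ℂ 2 (volume : Measure E3)] with x hx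
  rw [hx]
  simp

theorem IsWeakPartial.sum {ι : Type*} {k : Fin 3} {s : Finset ι} {u v : ι → L2}
    (h : ∀ i ∈ s, IsWeakPartial k (u i) (v i)) :
    IsWeakPartial k (∑ i ∈ s, u i) (∑ i ∈ s, v i) := by
  classical
  induction s using Finset.induction_on with
  | empty => simpa using isWeakPartial_zero k
  | insert a s ha ih =>
    rw [Finset.sum_insert ha, Finset.sum_insert ha]
    exact (h a (Finset.mem_insert_self a s)).add
      (ih fun i hi => h i (Finset.mem_insert_of_mem hi))

theorem WeaklyDiff.sum {ι : Type*} {s : Finset ι} {u : ι → L2} (h : ∀ i ∈ s, WeaklyDiff (u i)) :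
    WeaklyDiff (∑ i ∈ s, u i) :=
  weaklyDiff_of_forall_exists fun k => ⟨_, IsWeakPartial.sum fun i hi => h i hi k⟩

/-! ### Strong continuity of the free group -/

theorem norm_sq_eq_integral (f : L2) : ‖f‖ ^ 2 = ∫ x, ‖f x‖ ^ 2 := by
  rw [← inner_self_eq_norm_sq (𝕜 := ℂ) f, L2.inner_def, ← integral_re (L2.integrable_inner f f)]
  simp [inner_self_eq_norm_sq_to_K, ← Complex.ofReal_pow]

theorem integrable_norm_sq (f : L2) : Integrable fun x => ‖f x‖ ^ 2 :=
  (Lp.memLp f).integrable_norm_pow two_ne_zero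

/-- Dominated convergence: the squared difference of two unimodular symbols is at most 4. -/
theorem continuous_phaseMul (g : L2) : Continuous fun t : ℝ => phaseMul t 0 g := by
  refine continuous_iff_continuousAt.2 fun s => ?_
  rw [ContinuousAt, tendsto_iff_norm_sub_tendsto_zero]
  have h : Tendsto (fun t : ℝ => ‖phaseMul t 0 g - phaseMul s 0 g‖ ^ 2) (𝓝 s) (𝓝 0) := by
    have he : ∀ t : ℝ, ‖phaseMul t 0 g - phaseMul s 0 g‖ ^ 2 =
        ∫ ξ, ‖(phase t 0 ξ - phase s 0 ξ) * g ξ‖ ^ 2 := fun t => by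
      rw [norm_sq_eq_integral]
      refine integral_congr_ae ?_
      filter_upwards [Lp.coeFn_sub (phaseMul t 0 g) (phaseMul s 0 g), coeFn_phaseMul t 0 g,
        coeFn_phaseMul s 0 g] with ξ h1 h2 h3
      simp only [h1, Pi.sub_apply, h2, h3, sub_mul]
    simp_rw [he]
    have hz : (0 : ℝ) = ∫ ξ : E3, (0 : ℝ) := by simp
    rw [hz]
    refine tendsto_integral_filter_of_dominated_convergence (fun ξ => 4 * ‖g ξ‖ ^ 2) ?_ ?_
      ((integrable_norm_sq g).const_mul 4) ?_
    · refine Eventually.of_forall fun t => ?_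
      exact (((((continuous_phase t 0).sub (continuous_phase s 0)).aestronglyMeasurable).mul
        (Lp.aestronglyMeasurable g)).norm.pow 2)
    · refine Eventually.of_forall fun t => Eventually.of_forall fun ξ => ?_
      have h2 : ‖phase t 0 ξ - phase s 0 ξ‖ ≤ 2 := by
        refine (norm_sub_le _ _).trans ?_
        rw [norm_phase, norm_phase]
        norm_num
      rw [Real.norm_eq_abs, abs_of_nonneg (by positivity), norm_mul, mul_pow]
      gcongr
      nlinarith [norm_nonneg (phase t 0 ξ - phase s 0 ξ)]
    · refine Eventually.of_forall fun ξ => ?_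
      have hc : Continuous fun t : ℝ => ‖(phase t 0 ξ - phase s 0 ξ) * g ξ‖ ^ 2 := by
        unfold phase
        fun_prop
      have := hc.tendsto s
      simpa using this
  have h' := h.sqrt
  simpa [Real.sqrt_sq (norm_nonneg _)] using h'

theorem continuous_evolve (u : L2) : Continuous fun t : ℝ => evolve t 0 u :=
  (Lp.fourierTransformₗᵢ E3 ℂ).symm.continuous.comp (continuous_phaseMul (𝓕 u))

/-! ### The dispersive estimate -/

theorem iteratedDeriv_cexp_ofReal_mul_I (n : ℕ) :
    iteratedDeriv n (fun x : ℝ => Complex.exp ((x : ℂ) * Complex.I)) =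
      fun x : ℝ => Complex.I ^ n * Complex.exp ((x : ℂ) * Complex.I) := by
  induction n with
  | zero => simp
  | succ n ih =>
    rw [iteratedDeriv_succ, ih]
    ext x
    have h : HasDerivAt (fun x : ℝ => Complex.I ^ n * Complex.exp ((x : ℂ) * Complex.I))
        (Complex.I ^ n * (Complex.exp ((x : ℂ) * Complex.I) * (1 * Complex.I))) x :=
      ((((hasDerivAt_id x).ofReal_comp).mul_const Complex.I).cexp).const_mul _
    rw [h.deriv]
    ring

theorem hasTemperateGrowth_cexp_ofReal_mul_I :
    Function.HasTemperateGrowth (fun x : ℝ => Complex.exp ((x : ℂ) * Complex.I)) := by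
  refine ⟨?_, fun n => ⟨0, 1, fun x => ?_⟩⟩
  · exact Complex.contDiff_exp.comp (Complex.ofRealCLM.contDiff.mul contDiff_const)
  · rw [norm_iteratedFDeriv_eq_norm_iteratedDeriv, iteratedDeriv_cexp_ofReal_mul_I, norm_mul,
      norm_pow, Complex.norm_I, Complex.norm_exp_ofReal_mul_I]
    simp

theorem hasTemperateGrowth_phase (t : ℝ) (y : E3) : (phase t y).HasTemperateGrowth := by
  refine hasTemperateGrowth_cexp_ofReal_mul_I.comp (f := fun ξ : E3 =>
    (-(4 * Real.pi ^ 2 * t * ‖ξ‖ ^ 2 + 2 * Real.pi * inner ℝ y ξ) : ℝ)) ?_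
  have h1 : (fun ξ : E3 => ‖ξ‖ ^ 2).HasTemperateGrowth := Function.hasTemperateGrowth_norm_sq E3
  have h2 : (fun ξ : E3 => inner ℝ y ξ).HasTemperateGrowth :=
    Function.hasTemperateGrowth_inner_right y
  exact (((Function.HasTemperateGrowth.const _).mul h1).add
    ((Function.HasTemperateGrowth.const _).mul h2)).neg

/-- The free evolution on Schwartz functions. -/
def evolveSchwartz (t : ℝ) (y : E3) (f : 𝓢(E3, ℂ)) : 𝓢(E3, ℂ) :=
  𝓕⁻ (SchwartzMap.smulLeftCLM ℂ (phase t y) (𝓕 f))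

theorem evolve_toLp (t : ℝ) (y : E3) (f : 𝓢(E3, ℂ)) :
    evolve t y (f.toLp 2) = (evolveSchwartz t y f).toLp 2 := by
  apply fourier_injective
  rw [fourier_evolve, SchwartzMap.toLp_fourier_eq, SchwartzMap.toLp_fourier_eq, evolveSchwartz,
    FourierTransform.fourier_fourierInv_eq]
  ext1
  filter_upwards [coeFn_phaseMul t y ((𝓕 f).toLp 2), (𝓕 f).coeFn_toLp 2 volume,
    (SchwartzMap.smulLeftCLM ℂ (phase t y) (𝓕 f)).coeFn_toLp 2 volume] with ξ h1 h2 h3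
  rw [h1, h2, h3, SchwartzMap.smulLeftCLM_apply_apply (hasTemperateGrowth_phase t y), smul_eq_mul]

/-- The bound involves only |b|, so it survives as Re b tends to zero; the modulation by `x` merely
translates the transform. -/
theorem norm_fourier_gaussian_le {b : ℂ} (hb : 0 < b.re) (x w : E3) :
    ‖𝓕 (fun v : E3 => Complex.exp (-b * ‖v‖ ^ 2 + 2 * Real.pi * Complex.I * (inner ℝ x v : ℝ))) w‖ ≤
      (Real.pi / ‖b‖) ^ (3 / 2 : ℝ) := by
  rw [fourier_gaussian_innerProductSpace' hb, norm_mul]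
  have h1 : ‖((Real.pi : ℂ) / b) ^ (Module.finrank ℝ E3 / 2 : ℂ)‖ =
      (Real.pi / ‖b‖) ^ (3 / 2 : ℝ) := by
    have : (Module.finrank ℝ E3 / 2 : ℂ) = ((3 / 2 : ℝ) : ℂ) := by simp
    rw [this, Complex.norm_cpow_real, norm_div, Complex.norm_real, Real.norm_eq_abs,
      abs_of_pos Real.pi_pos]
  rw [h1]
  refine mul_le_of_le_one_right (by positivity) ?_
  rw [Complex.norm_exp, Real.exp_le_one_iff]
  have h2 : (-(Real.pi : ℂ) ^ 2 * (‖x - w‖ : ℂ) ^ 2 / b) =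
      ((-(Real.pi ^ 2 * ‖x - w‖ ^ 2) : ℝ) : ℂ) * b⁻¹ := by
    push_cast
    ring
  rw [h2, Complex.re_ofReal_mul, Complex.inv_re]
  have : 0 ≤ b.re / Complex.normSq b := div_nonneg hb.le (Complex.normSq_nonneg b)
  have h3 : 0 ≤ Real.pi ^ 2 * ‖x - w‖ ^ 2 := by positivity
  nlinarith

theorem integrable_gaussian_phase {b : ℂ} (hb : 0 < b.re) (x : E3) :
    Integrable fun v : E3 =>
      Complex.exp (-b * ‖v‖ ^ 2 + 2 * Real.pi * Complex.I * (inner ℝ x v : ℝ)) :=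
  GaussianFourier.integrable_cexp_neg_mul_sq_norm_add hb _ x

/-- The multiplication formula moves the Fourier transform from `f` to the Gaussian, whose transform
is bounded. -/
theorem norm_integral_gaussian_mul_fourier_le {b : ℂ} (hb : 0 < b.re) (x : E3) (f : 𝓢(E3, ℂ)) :
    ‖∫ ξ : E3, Complex.exp (-b * ‖ξ‖ ^ 2 + 2 * Real.pi * Complex.I * (inner ℝ x ξ : ℝ)) * 𝓕 f ξ‖ ≤
      (Real.pi / ‖b‖) ^ (3 / 2 : ℝ) * ∫ w, ‖f w‖ := by
  set G : E3 → ℂ := fun ξ =>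
    Complex.exp (-b * ‖ξ‖ ^ 2 + 2 * Real.pi * Complex.I * (inner ℝ x ξ : ℝ)) with hG
  have h : ∫ ξ : E3, 𝓕 G ξ * f ξ = ∫ ξ : E3, G ξ * 𝓕 f ξ := by
    have := VectorFourier.integral_fourierIntegral_smul_eq_flip (μ := (volume : Measure E3))
      (ν := (volume : Measure E3)) (L := innerₗ E3) (e := Real.fourierChar) (f := G) (g := f)
      Real.continuous_fourierChar continuous_inner (integrable_gaussian_phase hb x) f.integrable
    rw [flip_innerₗ] at this
    exact this
  rw [← h, ← integral_const_mul]
  refine norm_integral_le_of_norm_le (f.integrable.norm.const_mul _) (Eventually.of_forall ?_)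
  intro w
  rw [norm_mul]
  exact mul_le_mul_of_nonneg_right (norm_fourier_gaussian_le hb x w) (norm_nonneg _)

/-- The oscillating symbol is the limit, as ε decreases to 0, of Gaussians with b = ε + 4π²t·i, and
|b| ≥ |Im b| = 4π²|t| gives a bound independent of ε. -/
theorem norm_evolveSchwartz_le {t : ℝ} (ht : t ≠ 0) (f : 𝓢(E3, ℂ)) (x : E3) :
    ‖evolveSchwartz t 0 f x‖ ≤ (Real.pi / (4 * Real.pi ^ 2 * |t|)) ^ (3 / 2 : ℝ) * ∫ w, ‖f w‖ := by
  have hval : evolveSchwartz t 0 f x = ∫ ξ : E3, Complex.exp (2 * Real.pi * Complex.I *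
      (inner ℝ x ξ : ℝ)) * phase t 0 ξ * 𝓕 f ξ := by
    rw [evolveSchwartz, SchwartzMap.fourierInv_coe, Real.fourierInv_eq']
    refine integral_congr_ae (Eventually.of_forall fun ξ => ?_)
    simp only [SchwartzMap.smulLeftCLM_apply_apply (hasTemperateGrowth_phase t 0), smul_eq_mul]
    rw [mul_assoc (Complex.exp (2 * Real.pi * Complex.I * (inner ℝ x ξ : ℝ)))]
    congr 2
    rw [real_inner_comm]
    push_cast
    ring
  have hlim : Tendsto (fun ε : ℝ => ∫ ξ : E3, Complex.exp (-((ε : ℂ) + ((4 * Real.pi ^ 2 * t : ℝ) : ℂ) *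
      Complex.I) * ‖ξ‖ ^ 2 + 2 * Real.pi * Complex.I * (inner ℝ x ξ : ℝ)) * 𝓕 f ξ) (𝓝[>] 0)
      (𝓝 (evolveSchwartz t 0 f x)) := by
    rw [hval]
    refine tendsto_integral_filter_of_dominated_convergence (fun ξ => ‖𝓕 f ξ‖) ?_ ?_
      (𝓕 f).integrable.norm ?_
    · refine Eventually.of_forall fun ε => ?_
      have : Continuous fun ξ : E3 => Complex.exp (-((ε : ℂ) + ((4 * Real.pi ^ 2 * t : ℝ) : ℂ) *
        Complex.I) * ‖ξ‖ ^ 2 + 2 * Real.pi * Complex.I * (inner ℝ x ξ : ℝ)) := by fun_prop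
      exact (this.mul (𝓕 f).continuous).aestronglyMeasurable
    · filter_upwards [self_mem_nhdsWithin] with ε hε
      refine Eventually.of_forall fun ξ => ?_
      rw [norm_mul]
      refine mul_le_of_le_one_left (norm_nonneg _) ?_
      rw [Complex.norm_exp, Real.exp_le_one_iff]
      have : (-((ε : ℂ) + ((4 * Real.pi ^ 2 * t : ℝ) : ℂ) *
        Complex.I) * ‖ξ‖ ^ 2 + 2 * Real.pi * Complex.I * (inner ℝ x ξ : ℝ)) =
        ((-(ε * ‖ξ‖ ^ 2) : ℝ) : ℂ) + ((-(4 * Real.pi ^ 2 * t * ‖ξ‖ ^ 2) +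
          2 * Real.pi * inner ℝ x ξ : ℝ) : ℂ) * Complex.I := by
        push_cast
        ring
      rw [this, Complex.add_re, Complex.ofReal_re, Complex.re_ofReal_mul, Complex.I_re, mul_zero,
        add_zero, neg_nonpos]
      exact mul_nonneg (le_of_lt hε) (by positivity)
    · refine Eventually.of_forall fun ξ => ?_
      have hc : Continuous fun ε : ℝ => Complex.exp (-((ε : ℂ) + ((4 * Real.pi ^ 2 * t : ℝ) : ℂ) *
        Complex.I) * ‖ξ‖ ^ 2 + 2 * Real.pi * Complex.I * (inner ℝ x ξ : ℝ)) * 𝓕 f ξ := by fun_prop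
      have h0 := (hc.tendsto 0).mono_left (nhdsWithin_le_nhds (s := Set.Ioi 0))
      convert h0 using 2
      congr 1
      rw [phase, ← Complex.exp_add]
      congr 1
      simp
      ring
  refine le_of_tendsto hlim.norm ?_
  filter_upwards [self_mem_nhdsWithin] with ε hε
  have hε : 0 < ε := hε
  have hre : ((ε : ℂ) + ((4 * Real.pi ^ 2 * t : ℝ) : ℂ) * Complex.I).re = ε := by
    rw [Complex.add_re, Complex.ofReal_re, Complex.re_ofReal_mul, Complex.I_re, mul_zero, add_zero]
  have him : ((ε : ℂ) + ((4 * Real.pi ^ 2 * t : ℝ) : ℂ) * Complex.I).im = 4 * Real.pi ^ 2 * t := by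
    rw [Complex.add_im, Complex.ofReal_im, Complex.im_ofReal_mul, Complex.I_im, mul_one, zero_add]
  refine (norm_integral_gaussian_mul_fourier_le (by rwa [hre]) x f).trans ?_
  refine mul_le_mul_of_nonneg_right ?_ (integral_nonneg fun _ => norm_nonneg _)
  refine Real.rpow_le_rpow (by positivity) ?_ (by norm_num)
  refine div_le_div_of_nonneg_left Real.pi_pos.le (by positivity) ?_
  refine le_trans (le_of_eq ?_) (Complex.abs_im_le_norm _)
  rw [him, abs_mul, abs_of_pos (by positivity : 0 < 4 * Real.pi ^ 2)]

theorem tendsto_dispersive_const :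
    Tendsto (fun t : ℝ => (Real.pi / (4 * Real.pi ^ 2 * |t|)) ^ (3 / 2 : ℝ))
      (cocompact ℝ) (𝓝 0) := by
  have h1 : Tendsto (fun t : ℝ => 4 * Real.pi ^ 2 * |t|) (cocompact ℝ) atTop :=
    (tendsto_norm_cocompact_atTop (E := ℝ)).const_mul_atTop (by positivity)
  have h2 := (h1.const_div_atTop Real.pi).rpow_const (p := 3 / 2) (Or.inr (by norm_num))
  rwa [Real.zero_rpow (by norm_num)] at h2

/-! ### The Sobolev inequality -/

theorem norm_fderiv_le_sum (f : 𝓢(E3, ℂ)) (x : E3) :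
    ‖fderiv ℝ f x‖ ≤ ∑ k, ‖(∂_{(EuclideanSpace.single k (1 : ℝ) : E3)} f) x‖ := by
  refine ContinuousLinearMap.opNorm_le_bound _ (Finset.sum_nonneg fun _ _ => norm_nonneg _) ?_
  intro v
  have hv : v = ∑ k, v k • (EuclideanSpace.single k (1 : ℝ) : E3) := by
    ext i
    simp [Finset.sum_apply, Pi.single_apply]
  calc ‖fderiv ℝ f x v‖ = ‖∑ k, v k • fderiv ℝ f x (EuclideanSpace.single k (1 : ℝ))‖ := by
        conv_lhs => rw [hv]
        rw [map_sum]
        simp_rw [map_smul]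
    _ ≤ ∑ k, ‖v k • fderiv ℝ f x (EuclideanSpace.single k (1 : ℝ))‖ := norm_sum_le _ _
    _ ≤ ∑ k, ‖(∂_{(EuclideanSpace.single k (1 : ℝ) : E3)} f) x‖ * ‖v‖ := by
        refine Finset.sum_le_sum fun k _ => ?_
        rw [norm_smul, SchwartzMap.lineDerivOp_apply_eq_fderiv, mul_comm]
        exact mul_le_mul_of_nonneg_left (PiLp.norm_apply_le v k) (norm_nonneg _)
    _ = _ := by rw [Finset.sum_mul]

/-- The constant in the Sobolev inequality `‖u‖_{L⁶} ≤ C ‖∇u‖_{L²}`. -/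
def sobolevConst : NNReal := SNormLESNormFDerivOfEqConst ℂ (volume : Measure E3) 2

theorem eLpNorm_six_le_of_hasCompactSupport {f : E3 → ℂ} (hf : ContDiff ℝ 1 f)
    (hs : HasCompactSupport f) :
    eLpNorm f 6 volume ≤ sobolevConst * eLpNorm (fderiv ℝ f) 2 volume := by
  have := eLpNorm_le_eLpNorm_fderiv_of_eq (volume : Measure E3) hf hs (p := 2) (p' := 6)
    (by norm_num) (by simp) (by simp; norm_num)
  exact_mod_cast this

/-- Multiply by the dilated bumps χ(x/(n+1)). The product rule leaves an error from the gradient of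
the bump, which is of size 1/(n+1). -/
theorem exists_cutoff_approx (f : 𝓢(E3, ℂ)) : ∃ (g : ℕ → E3 → ℂ) (a : ℕ → ℝ),
    (∀ n, ContDiff ℝ 1 (g n)) ∧ (∀ n, HasCompactSupport (g n)) ∧ (∀ n, 0 ≤ a n) ∧
    Tendsto a atTop (𝓝 0) ∧ (∀ n x, ‖fderiv ℝ (g n) x‖ ≤ ‖fderiv ℝ f x‖ + a n * ‖f x‖) ∧
    ∀ x, Tendsto (fun n => g n x) atTop (𝓝 (f x)) := by
  let χ : ContDiffBump (0 : E3) := ⟨1, 2, one_pos, one_lt_two⟩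
  let c : ℕ → ℝ := fun n => ((n : ℝ) + 1)⁻¹
  have hc : ∀ n, 0 < c n := fun n => by positivity
  have hc0 : Tendsto c atTop (𝓝 0) := tendsto_inv_atTop_zero.comp
    (tendsto_atTop_add_const_right _ _ tendsto_natCast_atTop_atTop)
  let ρ : ℕ → E3 → ℝ := fun n x => χ (c n • x)
  have hρ : ∀ n, ContDiff ℝ 1 (ρ n) := fun n => χ.contDiff.comp (contDiff_const_smul (c n))
  have hρs : ∀ n, HasCompactSupport (ρ n) := fun n =>
    χ.hasCompactSupport.comp_smul (hc n).ne'
  obtain ⟨B, hB⟩ : ∃ B : ℝ, ∀ x, ‖fderiv ℝ χ x‖ ≤ B := by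
    have h1 : Continuous (fderiv ℝ χ) := (χ.contDiff (n := 1)).continuous_fderiv one_ne_zero
    obtain ⟨B, hB⟩ := h1.bounded_above_of_compact_support (χ.hasCompactSupport.fderiv ℝ)
    exact ⟨B, hB⟩
  have hB0 : 0 ≤ B := (norm_nonneg _).trans (hB 0)
  have hdρ : ∀ n x, ‖fderiv ℝ (ρ n) x‖ ≤ c n * B := fun n x => by
    have : fderiv ℝ (ρ n) x = c n • fderiv ℝ χ (c n • x) := fderiv_comp_smul (c n)
    rw [this, norm_smul, Real.norm_of_nonneg (hc n).le]
    exact mul_le_mul_of_nonneg_left (hB _) (hc n).le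
  let g : ℕ → E3 → ℂ := fun n x => ρ n x • f x
  have hg : ∀ n, ContDiff ℝ 1 (g n) := fun n => (hρ n).smul (f.smooth 1)
  have hgs : ∀ n, HasCompactSupport (g n) := fun n => (hρs n).smul_right
  have hdg : ∀ n x, ‖fderiv ℝ (g n) x‖ ≤ ‖fderiv ℝ f x‖ + c n * B * ‖f x‖ := fun n x => by
    have h : fderiv ℝ (g n) x = ρ n x • fderiv ℝ f x + (fderiv ℝ (ρ n) x).smulRight (f x) :=
      fderiv_fun_smul ((hρ n).differentiable one_ne_zero x) f.differentiableAt
    rw [h]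
    refine (norm_add_le _ _).trans (add_le_add ?_ ?_)
    · rw [norm_smul, Real.norm_of_nonneg χ.nonneg]
      exact mul_le_of_le_one_left (norm_nonneg _) χ.le_one
    · rw [ContinuousLinearMap.norm_smulRight_apply]
      exact mul_le_mul_of_nonneg_right (hdρ n x) (norm_nonneg _)
  refine ⟨g, fun n => c n * B, hg, hgs, fun n => mul_nonneg (hc n).le hB0, ?_, hdg, fun x => ?_⟩
  · simpa using hc0.mul_const B
  · have h1 : Tendsto (fun n => ρ n x) atTop (𝓝 1) := by
      have : Tendsto (fun n => χ (c n • x)) atTop (𝓝 (χ ((0 : ℝ) • x))) :=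
        (χ.continuous.tendsto _).comp (hc0.smul_const x)
      rwa [zero_smul, χ.one_of_mem_closedBall (by simp [χ])] at this
    have h2 := h1.smul_const (f x)
    rwa [one_smul] at h2

theorem eLpNorm_le_add_of_forall_norm_le {F : Type*} [NormedAddCommGroup F] {h : E3 → F}
    {p q : E3 → ℝ} {a : ℝ} (ha : 0 ≤ a) (hp : Continuous p) (hq : Continuous q)
    (hle : ∀ x, ‖h x‖ ≤ p x + a * q x) :
    eLpNorm h 2 volume ≤ eLpNorm p 2 volume + ENNReal.ofReal a * eLpNorm q 2 volume := by
  have h1 : eLpNorm h 2 volume ≤ eLpNorm (p + a • q) 2 volume :=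
    eLpNorm_mono_real fun x => by simpa using hle x
  refine h1.trans ((eLpNorm_add_le hp.aestronglyMeasurable
    (hq.const_smul a).aestronglyMeasurable one_le_two).trans ?_)
  rw [eLpNorm_const_smul, Real.enorm_of_nonneg ha]

theorem eLpNorm_six_le_fderiv (f : 𝓢(E3, ℂ)) :
    eLpNorm f 6 volume ≤ sobolevConst * eLpNorm (fderiv ℝ f) 2 volume := by
  obtain ⟨g, a, hg, hgs, ha, ha0, hdg, hlim⟩ := exists_cutoff_approx f
  have hfc : Continuous (fderiv ℝ f) := (f.smooth 1).continuous_fderiv one_ne_zero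
  -- Fatou's lemma on the left; on the right the cutoff error `a n * N` tends to zero. The norms are
  -- abstracted to keep the limit purely in extended nonnegative reals.
  have key : ∀ (K D N : ℝ≥0∞), K ≠ ⊤ → N ≠ ⊤ → (∀ n, eLpNorm (g n) 6 volume ≤
      K * (D + ENNReal.ofReal (a n) * N)) → eLpNorm f 6 volume ≤ K * D := by
    intro K D N hK hN hbd
    have h1 := ENNReal.Tendsto.mul_const (ENNReal.tendsto_ofReal ha0) (Or.inr hN)
    rw [ENNReal.ofReal_zero, zero_mul] at h1
    have hrhs := ENNReal.Tendsto.const_mul (h1.const_add D) (Or.inr hK)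
    rw [add_zero] at hrhs
    refine (Lp.eLpNorm_lim_le_liminf_eLpNorm (fun n => (hg n).continuous.aestronglyMeasurable) f
      (Eventually.of_forall hlim)).trans ?_
    rw [← hrhs.liminf_eq]
    exact liminf_le_liminf (Eventually.of_forall hbd)
  have hN : eLpNorm f 2 (volume : Measure E3) ≠ ⊤ := (f.memLp 2 (volume : Measure E3)).2.ne
  refine key sobolevConst _ (eLpNorm f 2 volume) ENNReal.coe_ne_top hN fun n => ?_
  refine (eLpNorm_six_le_of_hasCompactSupport (hg n) (hgs n)).trans ?_
  have h1 := eLpNorm_le_add_of_forall_norm_le (ha n) hfc.norm f.continuous.norm (hdg n)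
  rw [eLpNorm_norm, eLpNorm_norm] at h1
  exact mul_le_mul_of_nonneg_left h1 zero_le

theorem isWeakPartial_toLp (k : Fin 3) (f : 𝓢(E3, ℂ)) :
    IsWeakPartial k (f.toLp 2) ((∂_{(EuclideanSpace.single k (1 : ℝ) : E3)} f).toLp 2) := by
  rw [isWeakPartial_iff, SchwartzMap.toLp_fourier_eq, SchwartzMap.toLp_fourier_eq,
    SchwartzMap.fourier_lineDerivOp_eq]
  have htg : Function.HasTemperateGrowth
      (fun ξ : E3 => (inner ℝ ξ (EuclideanSpace.single k (1 : ℝ)) : ℝ)) := by fun_prop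
  filter_upwards [(𝓕 f).coeFn_toLp 2 volume, ((2 * Real.pi * Complex.I) • SchwartzMap.smulLeftCLM ℂ
    (fun ξ : E3 => (inner ℝ ξ (EuclideanSpace.single k (1 : ℝ)) : ℝ)) (𝓕 f)).coeFn_toLp 2 volume]
    with ξ h1 h2
  rw [h1, h2, smul_apply, SchwartzMap.smulLeftCLM_apply_apply htg,
    EuclideanSpace.inner_single_right]
  simp

theorem weaklyDiff_toLp (f : 𝓢(E3, ℂ)) : WeaklyDiff (f.toLp 2) :=
  weaklyDiff_of_forall_exists fun k => ⟨_, isWeakPartial_toLp k f⟩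

theorem eLpNorm_six_toLp_le (f : 𝓢(E3, ℂ)) :
    eLpNorm (f.toLp 2 : L2) 6 volume ≤
      ENNReal.ofReal (sobolevConst * ∑ k, ‖weakPartial k (f.toLp 2 : L2)‖) := by
  rw [eLpNorm_congr_ae (f.coeFn_toLp 2 volume), ENNReal.ofReal_mul (by positivity),
    ENNReal.ofReal_coe_nnreal]
  refine (eLpNorm_six_le_fderiv f).trans ?_
  gcongr
  let D : Fin 3 → 𝓢(E3, ℂ) := fun k => ∂_{(EuclideanSpace.single k (1 : ℝ) : E3)} f
  have hD : ∀ k, ENNReal.ofReal ‖weakPartial k (f.toLp 2 : L2)‖ = eLpNorm (D k) 2 volume :=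
    fun k => by
      rw [(isWeakPartial_toLp k f).weakPartial_eq, ofReal_norm, Lp.enorm_def]
      exact eLpNorm_congr_ae ((D k).coeFn_toLp 2 volume)
  rw [ENNReal.ofReal_sum_of_nonneg fun _ _ => norm_nonneg _]
  simp_rw [hD]
  have h1 : eLpNorm (fderiv ℝ f) 2 volume ≤
      eLpNorm (∑ k, fun x => ‖D k x‖) 2 (volume : Measure E3) := by
    refine eLpNorm_mono_real fun x => ?_
    rw [Finset.sum_apply]
    exact norm_fderiv_le_sum f x
  refine h1.trans ((eLpNorm_sum_le (fun k _ => (D k).continuous.norm.aestronglyMeasurable)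
    one_le_two).trans (le_of_eq ?_))
  exact Finset.sum_congr rfl fun k _ => eLpNorm_norm _

theorem fourier_sub (u v : L2) : (𝓕 (u - v) : L2) = 𝓕 u - 𝓕 v :=
  (Lp.fourierTransformₗᵢ E3 ℂ).map_sub u v

/-! ### Density of Schwartz functions -/

/-- The function (1 + |ξ|²)^{1/2} û is in L². A Schwartz function `h` close to it, divided by the
weight, is again Schwartz. Its inverse transform is close to `u` together with its derivatives,
because 1 and |ξ_k| are both dominated by the weight. -/
theorem exists_schwartz_approx {u : L2} (hu : WeaklyDiff u) {ε : ℝ} (hε : 0 < ε) :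
    ∃ f : 𝓢(E3, ℂ), ‖f.toLp 2 volume - u‖ < ε ∧
      ∀ k, ‖weakPartial k (f.toLp 2 volume) - weakPartial k u‖ < ε := by
  let m : E3 → ℝ := fun ξ => (1 + ‖ξ‖ ^ 2) ^ (1 / 2 : ℝ)
  let m' : E3 → ℝ := fun ξ => (1 + ‖ξ‖ ^ 2) ^ (-1 / 2 : ℝ)
  have hm' : m'.HasTemperateGrowth := Function.hasTemperateGrowth_one_add_norm_sq_rpow E3 (-1 / 2)
  have hmm' : ∀ ξ, m' ξ * m ξ = 1 := fun ξ => by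
    simp only [m, m']
    rw [← Real.rpow_add (by positivity)]
    norm_num
  have hm'0 : ∀ ξ, 0 < m' ξ := fun ξ => by positivity
  have hm0 : ∀ ξ, 0 < m ξ := fun ξ => by positivity
  have hmsq : ∀ ξ, m ξ ^ 2 = 1 + ‖ξ‖ ^ 2 := fun ξ => by
    simp only [m]
    rw [← Real.rpow_natCast, ← Real.rpow_mul (by positivity)]
    norm_num
  have hm1 : ∀ ξ, 1 ≤ m ξ := fun ξ => by
    nlinarith [hmsq ξ, hm0 ξ, sq_nonneg ‖ξ‖]
  have hmk : ∀ (k : Fin 3) ξ, |ξ k| ≤ m ξ := fun k ξ => by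
    have h1 : |ξ k| ≤ ‖ξ‖ := PiLp.norm_apply_le ξ k
    refine h1.trans (abs_le_of_sq_le_sq' ?_ (hm0 ξ).le).2
    rw [hmsq]
    linarith
  have hms : ∀ ξ, m ξ ≤ 1 + ∑ k, |ξ k| := fun ξ => by
    have h1 : ‖ξ‖ ^ 2 = ∑ k, |ξ k| ^ 2 := by
      rw [EuclideanSpace.norm_sq_eq]
      rfl
    refine (abs_le_of_sq_le_sq' ?_ (by positivity)).2
    rw [hmsq, h1, Fin.sum_univ_three, Fin.sum_univ_three]
    nlinarith [abs_nonneg (ξ 0), abs_nonneg (ξ 1), abs_nonneg (ξ 2),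
      mul_nonneg (abs_nonneg (ξ 0)) (abs_nonneg (ξ 1)),
      mul_nonneg (abs_nonneg (ξ 0)) (abs_nonneg (ξ 2)),
      mul_nonneg (abs_nonneg (ξ 1)) (abs_nonneg (ξ 2))]
  have hmc : Continuous m := by
    refine Continuous.rpow_const (by fun_prop) fun ξ => Or.inr (by norm_num)
  have hw : MemLp (fun ξ => (m ξ : ℂ) * (𝓕 u : L2) ξ) 2 volume := by
    have hdom : MemLp (fun ξ => ‖(𝓕 u : L2) ξ‖ + ∑ k, ‖(𝓕 (weakPartial k u) : L2) ξ‖) 2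
        (volume : Measure E3) :=
      (Lp.memLp _).norm.add (memLp_finsetSum _ fun k _ => (Lp.memLp _).norm)
    refine hdom.mono' ((Complex.continuous_ofReal.comp hmc).aestronglyMeasurable.mul
      (Lp.aestronglyMeasurable _)) ?_
    have hall : ∀ᵐ ξ, ∀ k, (𝓕 (weakPartial k u) : L2) ξ =
        (2 * Real.pi * Complex.I) * ((ξ k : ℂ) * (𝓕 u : L2) ξ) :=
      ae_all_iff.2 fun k => isWeakPartial_iff.1 (hu k)
    filter_upwards [hall] with ξ hξ
    rw [norm_mul, Complex.norm_real, Real.norm_of_nonneg (hm0 ξ).le]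
    have h1 : ∀ k, |ξ k| * ‖(𝓕 u : L2) ξ‖ ≤ ‖(𝓕 (weakPartial k u) : L2) ξ‖ := fun k => by
      rw [hξ k, norm_mul, norm_mul (ξ k : ℂ), Complex.norm_real, Real.norm_eq_abs]
      refine le_mul_of_one_le_left (by positivity) ?_
      simp only [norm_mul, Complex.norm_I, Complex.norm_real, mul_one, Complex.norm_ofNat,
        Real.norm_eq_abs, abs_of_pos Real.pi_pos]
      linarith [Real.pi_gt_three]
    calc m ξ * ‖(𝓕 u : L2) ξ‖ ≤ (1 + ∑ k, |ξ k|) * ‖(𝓕 u : L2) ξ‖ :=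
          mul_le_mul_of_nonneg_right (hms ξ) (norm_nonneg _)
      _ = ‖(𝓕 u : L2) ξ‖ + ∑ k, |ξ k| * ‖(𝓕 u : L2) ξ‖ := by
          rw [add_mul, one_mul, Finset.sum_mul]
      _ ≤ _ := by
          gcongr with k
          exact h1 k
  have hd := SchwartzMap.denseRange_toLpCLM (E := E3) (F := ℂ) (p := 2) (μ := volume)
    ENNReal.ofNat_ne_top
  -- The factor 2π compensates the one in the symbol 2πiξ_k.
  have hδ : 0 < ε / (2 * Real.pi) := by positivity
  obtain ⟨h, hh⟩ := hd.exists_dist_lt (hw.toLp _) hδ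
  rw [dist_comm, dist_eq_norm, SchwartzMap.toLpCLM_apply] at hh
  let f : 𝓢(E3, ℂ) := 𝓕⁻ (SchwartzMap.smulLeftCLM ℂ m' h)
  have hff : (𝓕 (f.toLp 2 volume - u) : L2) =ᵐ[volume] fun ξ => (m' ξ : ℂ) *
      (h.toLp 2 volume - hw.toLp _ : L2) ξ := by
    have e1 : (𝓕 (f.toLp 2 volume - u) : L2) = (SchwartzMap.smulLeftCLM ℂ m' h).toLp 2 volume - 𝓕 u := by
      rw [fourier_sub, SchwartzMap.toLp_fourier_eq,
        FourierTransform.fourier_fourierInv_eq]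
    rw [e1]
    filter_upwards [Lp.coeFn_sub ((SchwartzMap.smulLeftCLM ℂ m' h).toLp 2 volume) (𝓕 u),
      (SchwartzMap.smulLeftCLM ℂ m' h).coeFn_toLp 2 volume, h.coeFn_toLp 2 volume,
      hw.coeFn_toLp, Lp.coeFn_sub (h.toLp 2 volume) (hw.toLp _)] with ξ a1 a2 a3 a4 a5
    rw [a1, a5, Pi.sub_apply, Pi.sub_apply, a2, a3, a4,
      SchwartzMap.smulLeftCLM_apply_apply hm', mul_sub, ← mul_assoc, ← Complex.ofReal_mul, hmm',
      Complex.ofReal_one, one_mul, Complex.real_smul]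
  have hm'1 : ∀ ξ, m' ξ ≤ 1 := fun ξ => by
    have := mul_le_mul_of_nonneg_left (hm1 ξ) (hm'0 ξ).le
    rwa [hmm', mul_one] at this
  refine ⟨f, ?_, fun k => ?_⟩
  · have h1 : ‖(𝓕 (f.toLp 2 volume - u) : L2)‖ ≤ 1 * ‖(h.toLp 2 volume - hw.toLp _ : L2)‖ := by
      refine Lp.norm_le_mul_norm_of_ae_le_mul ?_
      filter_upwards [hff] with ξ hξ
      rw [hξ, norm_mul, Complex.norm_real, Real.norm_of_nonneg (hm'0 ξ).le]
      exact mul_le_mul_of_nonneg_right (hm'1 ξ) (norm_nonneg _)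
    rw [Lp.norm_fourier_eq, one_mul] at h1
    refine h1.trans_lt (hh.trans_le ?_)
    exact div_le_self hε.le (by linarith [Real.pi_gt_three])
  · have hw' := isWeakPartial_iff.1 (((weaklyDiff_toLp f) k).sub (hu k))
    have h1 : ‖(𝓕 (weakPartial k (f.toLp 2 volume) - weakPartial k u) : L2)‖ ≤
        (2 * Real.pi) * ‖(h.toLp 2 volume - hw.toLp _ : L2)‖ := by
      refine Lp.norm_le_mul_norm_of_ae_le_mul ?_
      filter_upwards [hff, hw'] with ξ hξ hξ'
      rw [hξ', hξ]
      simp only [norm_mul, Complex.norm_I, Complex.norm_real, mul_one, Complex.norm_ofNat,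
        Real.norm_eq_abs, abs_of_pos Real.pi_pos, abs_of_pos (hm'0 ξ)]
      rw [← mul_assoc |ξ k|]
      refine mul_le_mul_of_nonneg_left (mul_le_of_le_one_left (norm_nonneg _) ?_) (by positivity)
      rw [← hmm' ξ, mul_comm]
      exact mul_le_mul_of_nonneg_left (hmk k ξ) (hm'0 ξ).le
    rw [Lp.norm_fourier_eq] at h1
    refine h1.trans_lt ?_
    rwa [← lt_div_iff₀' (by positivity)]

/-- L² convergence implies convergence in measure, under which every L^p norm is lower
semicontinuous. -/
theorem eLpNorm_le_of_tendsto {u : ℕ → L2} {v : L2} (h : Tendsto u atTop (𝓝 v)) {p C : ℝ≥0∞}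
    (hb : ∀ᶠ n in atTop, eLpNorm (u n) p volume ≤ C) : eLpNorm v p volume ≤ C :=
  eLpNorm_le_of_tendstoInMeasure hb (tendstoInMeasure_of_tendsto_Lp h)
    fun n => Lp.aestronglyMeasurable (u n)

/-- Sobolev inequality `‖u‖_{L⁶} ≤ C ‖∇u‖_{L²}`. -/
theorem eLpNorm_six_le {u : L2} (hu : WeaklyDiff u) :
    eLpNorm u 6 volume ≤ ENNReal.ofReal (sobolevConst * ∑ k, ‖weakPartial k u‖) := by
  have hpos : ∀ n : ℕ, (0 : ℝ) < 1 / ((n : ℝ) + 1) := fun n => by positivity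
  choose f hf1 hf2 using fun n : ℕ => exists_schwartz_approx hu (hpos n)
  have h0 : Tendsto (fun n : ℕ => 1 / ((n : ℝ) + 1)) atTop (𝓝 0) :=
    tendsto_one_div_add_atTop_nhds_zero_nat
  have h1 : Tendsto (fun n => ((f n).toLp 2 volume : L2)) atTop (𝓝 u) :=
    tendsto_iff_norm_sub_tendsto_zero.2
      (squeeze_zero (fun _ => norm_nonneg _) (fun n => (hf1 n).le) h0)
  have h2 : ∀ k, Tendsto (fun n => weakPartial k ((f n).toLp 2 volume)) atTop (𝓝 (weakPartial k u)) :=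
    fun k => tendsto_iff_norm_sub_tendsto_zero.2
      (squeeze_zero (fun _ => norm_nonneg _) (fun n => (hf2 n k).le) h0)
  have h3 : Tendsto (fun n => ∑ k, ‖weakPartial k ((f n).toLp 2 volume)‖) atTop
      (𝓝 (∑ k, ‖weakPartial k u‖)) := tendsto_finsetSum _ fun k _ => (h2 k).norm
  refine ENNReal.le_of_forall_pos_le_add fun δ hδ _ => ?_
  have h4 : Tendsto (fun n => ENNReal.ofReal (sobolevConst * ∑ k, ‖weakPartial k ((f n).toLp 2 volume)‖))
      atTop (𝓝 (ENNReal.ofReal (sobolevConst * ∑ k, ‖weakPartial k u‖))) :=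
    ENNReal.tendsto_ofReal (h3.const_mul _)
  refine eLpNorm_le_of_tendsto h1 ?_
  filter_upwards [h4.eventually_lt_const (ENNReal.lt_add_right ENNReal.ofReal_ne_top
    (ENNReal.coe_pos.2 hδ).ne')] with n hn
  exact (eLpNorm_six_toLp_le (f n)).trans hn.le

/-! ### Interpolation -/

/-- Hölder's inequality applied to |f|² = |f|·|f|. All interpolation inequalities below are
instances. -/
theorem eLpNorm_two_mul_sq_le {α : Type*} [MeasurableSpace α] {μ : Measure α} {p q r : ℝ≥0∞}
    [ENNReal.HolderTriple p q r] {f : α → ℂ} (hf : AEStronglyMeasurable f μ) :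
    eLpNorm f (r * 2) μ ^ 2 ≤ eLpNorm f p μ * eLpNorm f q μ := by
  have h1 := eLpNorm_norm_rpow (p := r) (μ := μ) f (q := 2) two_pos
  rw [ENNReal.ofReal_ofNat, ENNReal.rpow_ofNat] at h1
  rw [← h1]
  have h2 := eLpNorm_le_eLpNorm_mul_eLpNorm'_of_norm (p := p) (q := q) (r := r) hf hf
    (fun a b => a * b) 1 (Eventually.of_forall fun x => by simp)
  rw [ENNReal.coe_one, one_mul] at h2
  refine le_trans (le_of_eq ?_) h2
  refine eLpNorm_congr_norm_ae (Eventually.of_forall fun x => ?_)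
  simp [sq]

instance holderTriple_three_six_two : ENNReal.HolderTriple 3 6 2 := ⟨by
  rw [← ENNReal.toReal_eq_toReal_iff' (by simp) (by simp), ENNReal.toReal_add (by simp) (by simp)]
  norm_num⟩

instance holderTriple_four_four_two : ENNReal.HolderTriple 4 4 2 := ⟨by
  rw [← ENNReal.toReal_eq_toReal_iff' (by simp) (by simp), ENNReal.toReal_add (by simp) (by simp)]
  norm_num⟩

instance holderTriple_two_six : ENNReal.HolderTriple 2 6 (3 / 2) := ⟨by
  rw [← ENNReal.toReal_eq_toReal_iff' (by simp) (by simp), ENNReal.toReal_add (by simp) (by simp)]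
  norm_num⟩

theorem eLpNorm_four_sq_le (u : L2) :
    eLpNorm u 4 volume ^ 2 ≤ eLpNorm u 3 volume * eLpNorm u 6 volume := by
  have := eLpNorm_two_mul_sq_le (p := 3) (q := 6) (r := 2) (Lp.aestronglyMeasurable u)
  have e : (2 : ℝ≥0∞) * 2 = 4 := by norm_num
  rwa [e] at this

theorem eLpNorm_three_sq_le (u : L2) :
    eLpNorm u 3 volume ^ 2 ≤ eLpNorm u 2 volume * eLpNorm u 6 volume := by
  have := eLpNorm_two_mul_sq_le (p := 2) (q := 6) (r := 3 / 2) (Lp.aestronglyMeasurable u)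
  have e : (3 / 2 : ℝ≥0∞) * 2 = 3 := ENNReal.div_mul_cancel (by simp) (by simp)
  rwa [e] at this

theorem WeaklyDiff.eLpNorm_six_lt_top {u : L2} (hu : WeaklyDiff u) :
    eLpNorm u 6 volume < ⊤ := (eLpNorm_six_le hu).trans_lt ENNReal.ofReal_lt_top

theorem WeaklyDiff.memLp_three {u : L2} (hu : WeaklyDiff u) : MemLp u 3 volume := by
  refine ⟨Lp.aestronglyMeasurable u, ?_⟩
  by_contra h
  have h1 := eLpNorm_three_sq_le u
  rw [not_lt_top_iff.1 h, ENNReal.top_pow two_ne_zero, top_le_iff] at h1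
  exact (ENNReal.mul_lt_top (Lp.eLpNorm_lt_top u) hu.eLpNorm_six_lt_top).ne h1

theorem WeaklyDiff.memLp_four {u : L2} (hu : WeaklyDiff u) : MemLp u 4 volume := by
  refine ⟨Lp.aestronglyMeasurable u, ?_⟩
  by_contra h
  have h1 := eLpNorm_four_sq_le u
  rw [not_lt_top_iff.1 h, ENNReal.top_pow two_ne_zero, top_le_iff] at h1
  exact (ENNReal.mul_lt_top hu.memLp_three.2 hu.eLpNorm_six_lt_top).ne h1

/-! ### The `L⁴` norm of weakly differentiable functions -/

/-- The space `L⁴(ℝ³; ℂ)`. -/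
abbrev L4 : Type := Lp ℂ 4 (volume : Measure E3)

instance fact_one_le_four : Fact ((1 : ℝ≥0∞) ≤ 4) := ⟨by norm_num⟩

/-- A weakly differentiable `L²` function as an element of `L⁴`. -/
def toL4 {u : L2} (hu : WeaklyDiff u) : L4 := hu.memLp_four.toLp u

theorem coeFn_toL4 {u : L2} (hu : WeaklyDiff u) : toL4 hu =ᵐ[volume] u := hu.memLp_four.coeFn_toLp

theorem ofReal_norm_toL4 {u : L2} (hu : WeaklyDiff u) :
    ENNReal.ofReal ‖toL4 hu‖ = eLpNorm u 4 volume := by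
  rw [ofReal_norm]
  exact Lp.enorm_toLp hu.memLp_four

theorem toL4_add {u v : L2} (hu : WeaklyDiff u) (hv : WeaklyDiff v) :
    toL4 (hu.add hv) = toL4 hu + toL4 hv := by
  ext1
  filter_upwards [coeFn_toL4 hu, coeFn_toL4 hv, coeFn_toL4 (hu.add hv), Lp.coeFn_add u v,
    Lp.coeFn_add (toL4 hu) (toL4 hv)] with x h1 h2 h3 h4 h5
  rw [h3, h5, h4, Pi.add_apply, Pi.add_apply, h1, h2]

theorem toL4_sub {u v : L2} (hu : WeaklyDiff u) (hv : WeaklyDiff v) :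
    toL4 (hu.sub hv) = toL4 hu - toL4 hv := by
  ext1
  filter_upwards [coeFn_toL4 hu, coeFn_toL4 hv, coeFn_toL4 (hu.sub hv), Lp.coeFn_sub u v,
    Lp.coeFn_sub (toL4 hu) (toL4 hv)] with x h1 h2 h3 h4 h5
  rw [h3, h5, h4, Pi.sub_apply, Pi.sub_apply, h1, h2]

theorem toL4_congr {u v : L2} (hu : WeaklyDiff u) (hv : WeaklyDiff v) (h : u = v) :
    toL4 hu = toL4 hv := by
  subst h
  rfl

/-- The sum of the `L²` norms of `u` and its first-order derivatives. -/
def h1Size (u : L2) : ℝ := ‖u‖ + ∑ k, ‖weakPartial k u‖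

theorem h1Size_nonneg (u : L2) : 0 ≤ h1Size u := by
  unfold h1Size
  positivity

theorem h1Size_evolve {u : L2} (hu : WeaklyDiff u) (t : ℝ) (y : E3) :
    h1Size (evolve t y u) = h1Size u := by
  simp only [h1Size, hu.weakPartial_evolve, LinearIsometry.norm_map]

/-- Two interpolations give ‖u‖₄⁴ ≤ ‖u‖₂ ‖u‖₆³, and `A` dominates both norms on the right. -/
theorem eLpNorm_four_le {u : L2} (hu : WeaklyDiff u) :
    eLpNorm u 4 volume ≤ ENNReal.ofReal ((1 + sobolevConst) * h1Size u) := by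
  set A := ENNReal.ofReal ((1 + sobolevConst) * h1Size u) with hA
  have hC : (0 : ℝ) ≤ sobolevConst := sobolevConst.2
  have hs : 0 ≤ ∑ k, ‖weakPartial k u‖ := Finset.sum_nonneg fun _ _ => norm_nonneg _
  have h2 : eLpNorm u 2 volume ≤ A := by
    rw [← Lp.enorm_def, ← ofReal_norm]
    refine ENNReal.ofReal_le_ofReal ?_
    unfold h1Size
    nlinarith [norm_nonneg u, mul_nonneg hC hs, mul_nonneg hC (norm_nonneg u)]
  have h6 : eLpNorm u 6 volume ≤ A := by
    refine (eLpNorm_six_le hu).trans (ENNReal.ofReal_le_ofReal ?_)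
    unfold h1Size
    nlinarith [norm_nonneg u, mul_nonneg hC hs, mul_nonneg hC (norm_nonneg u)]
  refine (ENNReal.pow_le_pow_left_iff (n := 4) (by norm_num)).1 ?_
  calc eLpNorm u 4 volume ^ 4 = (eLpNorm u 4 volume ^ 2) ^ 2 := by ring
    _ ≤ (eLpNorm u 3 volume * eLpNorm u 6 volume) ^ 2 := by
        gcongr
        exact eLpNorm_four_sq_le u
    _ = eLpNorm u 3 volume ^ 2 * eLpNorm u 6 volume ^ 2 := by ring
    _ ≤ eLpNorm u 2 volume * eLpNorm u 6 volume * eLpNorm u 6 volume ^ 2 := by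
        gcongr
        exact eLpNorm_three_sq_le u
    _ ≤ A * A * A ^ 2 := by gcongr
    _ = A ^ 4 := by ring

theorem norm_toL4_le {u : L2} (hu : WeaklyDiff u) :
    ‖toL4 hu‖ ≤ (1 + sobolevConst) * h1Size u := by
  have h := eLpNorm_four_le hu
  rw [← ofReal_norm_toL4 hu] at h
  refine (ENNReal.ofReal_le_ofReal_iff (mul_nonneg ?_ (h1Size_nonneg u))).1 h
  positivity

/-- Translation on `L⁴`. -/
def translateL4 (y : E3) : L4 →ₗᵢ[ℂ] L4 :=
  Lp.compMeasurePreservingₗᵢ ℂ (fun x : E3 => x - y) (measurePreserving_sub_right volume y)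

theorem coeFn_translateL4 (y : E3) (a : L4) :
    translateL4 y a =ᵐ[volume] fun x => a (x - y) :=
  Lp.coeFn_compMeasurePreserving a (measurePreserving_sub_right volume y)

/-- The time evolution is not an isometry of L⁴, but the translation is; splitting it off leaves a
quantity that depends on time alone. -/
theorem toL4_evolve {u : L2} (hu : WeaklyDiff u) (t : ℝ) (y : E3) :
    toL4 (hu.evolve t y) = translateL4 y (toL4 (hu.evolve t 0)) := by
  have h0 : evolve t y u =ᵐ[volume] fun x => evolve t 0 u (x - y) := by
    rw [evolve_eq_translate]
    exact Lp.coeFn_compMeasurePreserving (evolve t 0 u) (measurePreserving_sub_right volume y)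
  have h1 := (measurePreserving_sub_right (volume : Measure E3) y).quasiMeasurePreserving.ae
    (coeFn_toL4 (hu.evolve t 0))
  ext1
  filter_upwards [coeFn_toL4 (hu.evolve t y), coeFn_translateL4 y (toL4 (hu.evolve t 0)), h0, h1]
    with x a1 a2 a3 a4
  rw [a1, a2, a3, a4]

theorem norm_toL4_evolve {u : L2} (hu : WeaklyDiff u) (t : ℝ) (y : E3) :
    ‖toL4 (hu.evolve t y)‖ = ‖toL4 (hu.evolve t 0)‖ := by
  rw [toL4_evolve hu, LinearIsometry.norm_map]

/-- The evolution commutes with derivatives, so strong continuity in L² of `u` and of its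
derivatives passes to L⁴ by the embedding of H¹. -/
theorem continuous_toL4_evolve {u : L2} (hu : WeaklyDiff u) :
    Continuous fun t : ℝ => toL4 (hu.evolve t 0) := by
  refine continuous_iff_continuousAt.2 fun s => ?_
  rw [ContinuousAt, tendsto_iff_norm_sub_tendsto_zero]
  have hb : ∀ t : ℝ, ‖toL4 (hu.evolve t 0) - toL4 (hu.evolve s 0)‖ ≤
      (1 + sobolevConst) * (‖evolve t 0 u - evolve s 0 u‖ +
        ∑ k, ‖evolve t 0 (weakPartial k u) - evolve s 0 (weakPartial k u)‖) := fun t => by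
    rw [← toL4_sub]
    refine (norm_toL4_le _).trans (le_of_eq ?_)
    simp only [h1Size, (hu.evolve t 0).weakPartial_sub (hu.evolve s 0), hu.weakPartial_evolve]
  refine squeeze_zero (fun _ => norm_nonneg _) hb ?_
  have hc : Continuous fun t : ℝ => (1 + sobolevConst : ℝ) * (‖evolve t 0 u - evolve s 0 u‖ +
        ∑ k, ‖evolve t 0 (weakPartial k u) - evolve s 0 (weakPartial k u)‖) := by
    refine continuous_const.mul (Continuous.add ?_ (continuous_finsetSum _ fun k _ => ?_))
    · exact ((continuous_evolve u).sub continuous_const).norm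
    · exact ((continuous_evolve _).sub continuous_const).norm
  simpa using hc.tendsto s

/-! ### Decay of the free evolution in `L⁴` -/

/-- Interpolation of the dispersive L^∞ decay with the conserved L² norm: ‖u‖₄² ≤ ‖u‖_∞ ‖u‖₂. -/
theorem tendsto_toL4_evolve_toLp (f : 𝓢(E3, ℂ)) :
    Tendsto (fun t : ℝ => ‖toL4 ((weaklyDiff_toLp f).evolve t 0)‖) (cocompact ℝ) (𝓝 0) := by
  let c : ℝ → ℝ := fun t => (Real.pi / (4 * Real.pi ^ 2 * |t|)) ^ (3 / 2 : ℝ)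
  let u : L2 := f.toLp 2 volume
  have hc : ∀ t, 0 ≤ c t := fun t => by positivity
  have hb : ∀ t : ℝ, t ≠ 0 →
      ‖toL4 ((weaklyDiff_toLp f).evolve t 0)‖ ^ 2 ≤ (c t * ∫ w, ‖f w‖) * ‖u‖ := fun t ht => by
    have h1 := eLpNorm_two_mul_sq_le (p := ⊤) (q := 2) (r := 2)
      (Lp.aestronglyMeasurable (evolve t 0 u))
    have e : (2 : ℝ≥0∞) * 2 = 4 := by norm_num
    rw [e, ← ofReal_norm_toL4 ((weaklyDiff_toLp f).evolve t 0)] at h1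
    have h2 : eLpNorm (evolve t 0 u) 2 volume = ENNReal.ofReal ‖u‖ := by
      rw [← Lp.enorm_def, ← ofReal_norm, LinearIsometry.norm_map]
    have h3 : eLpNorm (evolve t 0 u) ⊤ volume ≤ ENNReal.ofReal (c t * ∫ w, ‖f w‖) := by
      rw [eLpNorm_exponent_top]
      refine eLpNormEssSup_le_of_ae_bound ?_
      rw [evolve_toLp]
      filter_upwards [(evolveSchwartz t 0 f).coeFn_toLp 2 volume] with x hx
      rw [hx]
      exact norm_evolveSchwartz_le ht f x
    rw [h2, ← ENNReal.ofReal_pow (norm_nonneg _)] at h1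
    have h4 := h1.trans (mul_le_mul_of_nonneg_right h3 zero_le)
    have hI : 0 ≤ ∫ w, ‖f w‖ := integral_nonneg fun _ => norm_nonneg _
    rw [← ENNReal.ofReal_mul (mul_nonneg (hc t) hI)] at h4
    exact (ENNReal.ofReal_le_ofReal_iff
      (mul_nonneg (mul_nonneg (hc t) hI) (norm_nonneg _))).1 h4
  have h5 : Tendsto (fun t : ℝ => ‖toL4 ((weaklyDiff_toLp f).evolve t 0)‖ ^ 2)
      (cocompact ℝ) (𝓝 0) := by
    have h6 := (tendsto_dispersive_const.mul_const (∫ w, ‖f w‖)).mul_const ‖u‖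
    rw [zero_mul, zero_mul] at h6
    refine squeeze_zero' (Eventually.of_forall fun _ => sq_nonneg _) ?_ h6
    filter_upwards [(isCompact_singleton (x := (0 : ℝ))).compl_mem_cocompact] with t ht
    exact hb t ht
  have h7 := h5.sqrt
  simpa [Real.sqrt_sq (norm_nonneg _)] using h7

theorem tendsto_toL4_evolve {u : L2} (hu : WeaklyDiff u) :
    Tendsto (fun t : ℝ => ‖toL4 (hu.evolve t 0)‖) (cocompact ℝ) (𝓝 0) := by
  have hK : (0 : ℝ) < 1 + sobolevConst := by positivity
  rw [Metric.tendsto_nhds]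
  intro ε hε
  -- The 4 counts the norms in `h1Size`: one of the function and three of its derivatives.
  have hδ : 0 < ε / (2 * ((1 + sobolevConst) * 4)) := by positivity
  obtain ⟨f, hf1, hf2⟩ := exists_schwartz_approx hu hδ
  have hw := weaklyDiff_toLp f
  have hsz : (1 + sobolevConst) * h1Size (f.toLp 2 volume - u) ≤ ε / 2 := by
    have : h1Size (f.toLp 2 volume - u) ≤ 4 * (ε / (2 * ((1 + sobolevConst) * 4))) := by
      simp only [h1Size, hw.weakPartial_sub hu, Fin.sum_univ_three]
      linarith [hf1.le, (hf2 0).le, (hf2 1).le, (hf2 2).le]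
    calc (1 + sobolevConst) * h1Size (f.toLp 2 volume - u) ≤
        (1 + sobolevConst) * (4 * (ε / (2 * ((1 + sobolevConst) * 4)))) :=
          mul_le_mul_of_nonneg_left this hK.le
      _ = ε / 2 := by field_simp
  filter_upwards [(tendsto_toL4_evolve_toLp f).eventually_lt_const (half_pos hε)] with t ht
  rw [dist_zero_right, norm_norm]
  have h1 : toL4 (hu.evolve t 0) = toL4 (hw.evolve t 0) - toL4 ((hw.sub hu).evolve t 0) := by
    rw [← toL4_sub]
    refine toL4_congr _ _ ?_
    rw [map_sub, sub_sub_cancel]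
  have h2 : ‖toL4 ((hw.sub hu).evolve t 0)‖ ≤ ε / 2 := by
    refine (norm_toL4_le _).trans ?_
    rwa [h1Size_evolve (hw.sub hu)]
  rw [h1]
  refine (norm_sub_le _ _).trans_lt ?_
  linarith

/-! ### Products of `L⁴` functions -/

/-- The product `L⁴ × L⁴ → L²`. -/
def mulL4 : L4 →L[ℂ] L4 →L[ℂ] L2 := (ContinuousLinearMap.mul ℂ ℂ).holderL volume 4 4 2

theorem coeFn_mulL4 (a b : L4) : mulL4 a b =ᵐ[volume] fun x => a x * b x :=
  (ContinuousLinearMap.mul ℂ ℂ).coeFn_holder (r := 2) a b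

theorem norm_mulL4_le (a b : L4) : ‖mulL4 a b‖ ≤ ‖a‖ * ‖b‖ := by
  have h := (ContinuousLinearMap.mul ℂ ℂ).norm_holder_apply_apply_le (r := 2) a b
  refine h.trans ?_
  rw [mul_assoc]
  exact mul_le_of_le_one_left (by positivity) (ContinuousLinearMap.opNorm_mul_le ℂ ℂ)

theorem norm_inner_le_eLpNorm {p q : ℝ≥0∞} [ENNReal.HolderTriple p q 1] {f g a b : E3 → ℂ}
    (ha : AEStronglyMeasurable a volume) (hb : AEStronglyMeasurable b volume)
    (h : ∀ᵐ x, ‖f x‖ * ‖g x‖ ≤ ‖a x‖ * ‖b x‖) :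
    ENNReal.ofReal ‖∫ x, inner ℂ (f x) (g x)‖ ≤ eLpNorm a p volume * eLpNorm b q volume := by
  have h2 := eLpNorm_le_eLpNorm_mul_eLpNorm'_of_norm (p := p) (q := q) (r := 1) ha hb
    (fun a b => a * b) 1 (Eventually.of_forall fun x => by simp)
  rw [ENNReal.coe_one, one_mul, eLpNorm_one_eq_lintegral_enorm] at h2
  refine le_trans ?_ h2
  rw [ofReal_norm]
  refine (enorm_integral_le_lintegral_enorm _).trans (lintegral_mono_ae ?_)
  filter_upwards [h] with x hx
  rw [← ofReal_norm, ← ofReal_norm]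
  refine ENNReal.ofReal_le_ofReal ((norm_inner_le_norm _ _).trans (hx.trans ?_))
  rw [norm_mul]

/-- The moduli satisfy |ab||cd| = |ad||cb|; Cauchy-Schwarz follows. Exchanging the factors turns
diagonal products into mixed ones, which are the ones known to vanish. -/
theorem norm_inner_mulL4_le (a b c d : L4) :
    ‖inner ℂ (mulL4 a b) (mulL4 c d)‖ ≤ ‖mulL4 a d‖ * ‖mulL4 c b‖ := by
  have h := norm_inner_le_eLpNorm (p := 2) (q := 2) (f := mulL4 a b) (g := mulL4 c d)
    (Lp.aestronglyMeasurable (mulL4 a d)) (Lp.aestronglyMeasurable (mulL4 c b)) (by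
      filter_upwards [coeFn_mulL4 a b, coeFn_mulL4 c d, coeFn_mulL4 a d, coeFn_mulL4 c b]
        with x h1 h2 h3 h4
      rw [h1, h2, h3, h4, norm_mul, norm_mul, norm_mul, norm_mul]
      exact le_of_eq (by ring))
  rw [← L2.inner_def, ← Lp.enorm_def, ← Lp.enorm_def, ← ofReal_norm, ← ofReal_norm,
    ← ENNReal.ofReal_mul (norm_nonneg _)] at h
  exact (ENNReal.ofReal_le_ofReal_iff (by positivity)).1 h

/-! ### Separation in space -/

theorem exists_hasCompactSupport_approx (a : L4) {ε : ℝ} (hε : 0 < ε) :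
    ∃ (b : L4) (g : E3 → ℂ), HasCompactSupport g ∧ b =ᵐ[volume] g ∧ ‖a - b‖ ≤ ε := by
  obtain ⟨g, hg, hle, -, hm⟩ := (Lp.memLp a).exists_hasCompactSupport_eLpNorm_sub_le
    ENNReal.ofNat_ne_top (ENNReal.ofReal_pos.2 hε).ne'
  refine ⟨hm.toLp g, g, hg, hm.coeFn_toLp, ?_⟩
  rw [← ENNReal.ofReal_le_ofReal_iff hε.le, ofReal_norm, Lp.enorm_def]
  refine le_trans (le_of_eq (eLpNorm_congr_ae ?_)) hle
  filter_upwards [Lp.coeFn_sub a (hm.toLp g), hm.coeFn_toLp] with x h1 h2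
  rw [h1, Pi.sub_apply, Pi.sub_apply, h2]

/-- After approximation by compactly supported functions, the translated supports are disjoint once
the shifts are far enough apart. -/
theorem tendsto_mulL4_translateL4 (a b : L4) {y z : ℕ → E3}
    (h : Tendsto (fun n => ‖y n - z n‖) atTop atTop) :
    Tendsto (fun n => ‖mulL4 (translateL4 (y n) a) (translateL4 (z n) b)‖) atTop (𝓝 0) := by
  rw [Metric.tendsto_nhds]
  intro ε hε
  -- The total error is at most δ‖b‖ + (‖a‖ + 1)δ, where δ ≤ 1 is used to bound the norm of the
  -- approximation of `a` by ‖a‖ + 1.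
  set δ : ℝ := min 1 (ε / (‖a‖ + ‖b‖ + 2)) with hδd
  have hδ : 0 < δ := lt_min one_pos (by positivity)
  obtain ⟨a', f, hf, haf, ha⟩ := exists_hasCompactSupport_approx a hδ
  obtain ⟨b', g, hg, hbg, hb⟩ := exists_hasCompactSupport_approx b hδ
  obtain ⟨R, hR⟩ := hf.isBounded.exists_norm_le
  obtain ⟨S, hS⟩ := hg.isBounded.exists_norm_le
  filter_upwards [h.eventually_gt_atTop (R + S)] with n hn
  have hz : mulL4 (translateL4 (y n) a') (translateL4 (z n) b') = 0 := by
    ext1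
    have q1 := (measurePreserving_sub_right (volume : Measure E3) (y n)).quasiMeasurePreserving.ae
      haf
    have q2 := (measurePreserving_sub_right (volume : Measure E3) (z n)).quasiMeasurePreserving.ae
      hbg
    filter_upwards [coeFn_mulL4 (translateL4 (y n) a') (translateL4 (z n) b'),
      coeFn_translateL4 (y n) a', coeFn_translateL4 (z n) b', q1, q2,
      Lp.coeFn_zero ℂ 2 (volume : Measure E3)] with x h1 h2 h3 h4 h5 h6
    rw [h1, h2, h3, h4, h5, h6, Pi.zero_apply]
    by_contra hne
    have c1 := hR _ (subset_tsupport f (left_ne_zero_of_mul hne))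
    have c2 := hS _ (subset_tsupport g (right_ne_zero_of_mul hne))
    have c3 : ‖y n - z n‖ ≤ ‖x - y n‖ + ‖x - z n‖ := by
      have : y n - z n = (x - z n) - (x - y n) := by abel
      rw [this, add_comm]
      exact norm_sub_le _ _
    linarith
  have hsplit : mulL4 (translateL4 (y n) a) (translateL4 (z n) b) =
      mulL4 (translateL4 (y n) (a - a')) (translateL4 (z n) b) +
        mulL4 (translateL4 (y n) a') (translateL4 (z n) (b - b')) := by
    simp only [map_sub, sub_apply, hz]
    abel
  have ha' : ‖a'‖ ≤ ‖a‖ + 1 := by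
    have : a' = a - (a - a') := by abel
    rw [this]
    exact (norm_sub_le _ _).trans (by linarith [min_le_left 1 (ε / (‖a‖ + ‖b‖ + 2))])
  rw [dist_zero_right, norm_norm, hsplit]
  have e1 := norm_mulL4_le (translateL4 (y n) (a - a')) (translateL4 (z n) b)
  have e2 := norm_mulL4_le (translateL4 (y n) a') (translateL4 (z n) (b - b'))
  simp only [LinearIsometry.norm_map] at e1 e2
  have hδ2 : δ * (‖a‖ + ‖b‖ + 2) ≤ ε := by
    rw [← le_div_iff₀ (by positivity)]
    exact min_le_right _ _
  calc _ ≤ ‖a - a'‖ * ‖b‖ + ‖a'‖ * ‖b - b'‖ := (norm_add_le _ _).trans (add_le_add e1 e2)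
    _ ≤ δ * ‖b‖ + (‖a‖ + 1) * δ := by gcongr
    _ < δ * (‖a‖ + ‖b‖ + 2) := by nlinarith
    _ ≤ ε := hδ2

/-! ### Asymptotic orthogonality of profiles -/

theorem tendsto_cocompact_of_norm {α E : Type*} [NormedAddCommGroup E] [ProperSpace E]
    {l : Filter α} {f : α → E} (h : Tendsto (fun a => ‖f a‖) l atTop) :
    Tendsto f l (cocompact E) := by
  rw [← Metric.cobounded_eq_cocompact, ← comap_norm_atTop]
  exact tendsto_comap_iff.2 h

theorem exists_subseq_tendsto_or_cocompact (s : ℕ → ℝ) :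
    ∃ φ : ℕ → ℕ, StrictMono φ ∧
      (Tendsto (s ∘ φ) atTop (cocompact ℝ) ∨ ∃ σ, Tendsto (s ∘ φ) atTop (𝓝 σ)) := by
  by_cases h : Tendsto (fun n => ‖s n‖) atTop atTop
  · exact ⟨id, strictMono_id, Or.inl (tendsto_cocompact_of_norm h)⟩
  · obtain ⟨R, hR⟩ : ∃ R, ∃ᶠ n in atTop, ‖s n‖ < R := by
      simpa [tendsto_atTop, Filter.Frequently] using h
    obtain ⟨σ, -, φ, hφ, hσ⟩ := tendsto_subseq_of_frequently_bounded
      (Metric.isBounded_ball (x := (0 : ℝ)) (r := R)) (x := s) (hR.mono fun n hn => by simpa using hn)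
    exact ⟨φ, hφ, Or.inr ⟨σ, hσ⟩⟩

/-- Along a subsequence each time sequence escapes to infinity or converges. In the first case that
factor decays in L⁴ while the other stays bounded. If both converge, the profiles may be frozen at
the limit times and only their spatial separation matters. -/
theorem tendsto_mulL4_evolve {u v : L2} (hu : WeaklyDiff u) (hv : WeaklyDiff v)
    {s t : ℕ → ℝ} {y z : ℕ → E3}
    (h : Tendsto (fun n => |s n - t n| + ‖y n - z n‖) atTop atTop) :
    Tendsto (fun n => ‖mulL4 (toL4 (hu.evolve (s n) (y n))) (toL4 (hv.evolve (t n) (z n)))‖)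
      atTop (𝓝 0) := by
  have hbdd : ∀ {w : L2} (hw : WeaklyDiff w) (t : ℝ), ‖toL4 (hw.evolve t 0)‖ ≤
      (1 + sobolevConst) * h1Size w := fun hw t =>
    (norm_toL4_le _).trans_eq (by rw [h1Size_evolve hw])
  refine tendsto_of_subseq_tendsto fun ns hns => ?_
  obtain ⟨φ, hφ, hs⟩ := exists_subseq_tendsto_or_cocompact (s ∘ ns)
  obtain ⟨χ, hχ, ht⟩ := exists_subseq_tendsto_or_cocompact (t ∘ ns ∘ φ)
  refine ⟨φ ∘ χ, ?_⟩
  have hle : ∀ n, ‖mulL4 (toL4 (hu.evolve (s n) (y n))) (toL4 (hv.evolve (t n) (z n)))‖ ≤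
      ‖toL4 (hu.evolve (s n) 0)‖ * ‖toL4 (hv.evolve (t n) 0)‖ := fun n => by
    refine (norm_mulL4_le _ _).trans_eq ?_
    rw [norm_toL4_evolve hu, norm_toL4_evolve hv]
  rcases hs with hs | ⟨σ, hs⟩
  · have h1 := (tendsto_toL4_evolve hu).comp (hs.comp hχ.tendsto_atTop)
    refine squeeze_zero (fun _ => norm_nonneg _) (fun n => (hle _).trans
      (mul_le_mul_of_nonneg_left (hbdd hv _) (norm_nonneg _))) ?_
    simpa using h1.mul_const ((1 + sobolevConst) * h1Size v)
  rcases ht with ht | ⟨τ, ht⟩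
  · have h1 := (tendsto_toL4_evolve hv).comp ht
    refine squeeze_zero (fun _ => norm_nonneg _) (fun n => (hle _).trans
      (mul_le_mul_of_nonneg_right (hbdd hu _) (norm_nonneg _))) ?_
    simpa using h1.const_mul ((1 + sobolevConst) * h1Size u)
  · set m : ℕ → ℕ := fun n => ns ((φ ∘ χ) n) with hm
    have hmt : Tendsto m atTop atTop := hns.comp ((hφ.comp hχ).tendsto_atTop)
    have hs' : Tendsto (fun n => s (m n)) atTop (𝓝 σ) := hs.comp hχ.tendsto_atTop
    have ht' : Tendsto (fun n => t (m n)) atTop (𝓝 τ) := ht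
    -- The time gap converges, so subtracting it leaves the space gap divergent.
    have hyz : Tendsto (fun n => ‖y (m n) - z (m n)‖) atTop atTop := by
      refine ((h.comp hmt).atTop_add (hs'.sub ht').abs.neg).congr fun n => ?_
      simp only [Function.comp_apply]
      ring
    set a := toL4 (hu.evolve σ 0)
    set b := toL4 (hv.evolve τ 0)
    have ha : Tendsto (fun n => ‖toL4 (hu.evolve (s (m n)) 0) - a‖) atTop (𝓝 0) :=
      tendsto_iff_norm_sub_tendsto_zero.1 (((continuous_toL4_evolve hu).tendsto σ).comp hs')
    have hb : Tendsto (fun n => ‖toL4 (hv.evolve (t (m n)) 0) - b‖) atTop (𝓝 0) :=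
      tendsto_iff_norm_sub_tendsto_zero.1 (((continuous_toL4_evolve hv).tendsto τ).comp ht')
    have h0 := tendsto_mulL4_translateL4 a b hyz
    have hlim := (h0.add (ha.mul_const ‖b‖)).add
      (hb.const_mul ((1 + sobolevConst) * h1Size u))
    rw [zero_mul, mul_zero, add_zero, add_zero] at hlim
    refine squeeze_zero (fun _ => norm_nonneg _) (fun n => ?_) hlim
    change ‖mulL4 (toL4 (hu.evolve (s (m n)) (y (m n)))) (toL4 (hv.evolve (t (m n)) (z (m n))))‖ ≤ _
    rw [toL4_evolve hu (s (m n)) (y (m n)), toL4_evolve hv (t (m n)) (z (m n))]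
    set A := toL4 (hu.evolve (s (m n)) 0)
    set B := toL4 (hv.evolve (t (m n)) 0)
    have hsplit : mulL4 (translateL4 (y (m n)) A) (translateL4 (z (m n)) B) =
        mulL4 (translateL4 (y (m n)) a) (translateL4 (z (m n)) b) +
        mulL4 (translateL4 (y (m n)) (A - a)) (translateL4 (z (m n)) b) +
        mulL4 (translateL4 (y (m n)) A) (translateL4 (z (m n)) (B - b)) := by
      simp only [map_sub, sub_apply]
      abel
    have e1 := norm_mulL4_le (translateL4 (y (m n)) (A - a)) (translateL4 (z (m n)) b)
    have e2 := norm_mulL4_le (translateL4 (y (m n)) A) (translateL4 (z (m n)) (B - b))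
    simp only [LinearIsometry.norm_map] at e1 e2
    rw [hsplit]
    refine (norm_add_le _ _).trans (add_le_add ((norm_add_le _ _).trans (add_le_add le_rfl e1))
      (e2.trans ?_))
    exact mul_le_mul_of_nonneg_right (hbdd hu _) (norm_nonneg _)

/-! ### Weak convergence to zero of separated evolutions -/

instance holderTriple_fourThirds : ENNReal.HolderTriple (4 / 3) 4 1 := ⟨by
  rw [← ENNReal.toReal_eq_toReal_iff' (by simp) (by simp), ENNReal.toReal_add (by simp) (by simp)]
  norm_num⟩

instance holderTriple_threeHalves : ENNReal.HolderTriple (3 / 2) 3 1 := ⟨by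
  rw [← ENNReal.toReal_eq_toReal_iff' (by simp) (by simp), ENNReal.toReal_add (by simp) (by simp)]
  norm_num⟩

theorem ofReal_norm_inner_toLp_le {p q : ℝ≥0∞} [ENNReal.HolderTriple p q 1] (f : 𝓢(E3, ℂ))
    (u : L2) : ENNReal.ofReal ‖inner ℂ (f.toLp 2 volume) u‖ ≤
      eLpNorm f p volume * eLpNorm u q volume := by
  rw [L2.inner_def]
  refine norm_inner_le_eLpNorm f.continuous.aestronglyMeasurable (Lp.aestronglyMeasurable u) ?_
  filter_upwards [f.coeFn_toLp 2 volume] with x hx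
  rw [hx]

/-- Plancherel turns the translation into a modulation of an integrable function; Riemann-Lebesgue
concludes. -/
theorem tendsto_inner_translate (u v : L2) {y : ℕ → E3}
    (h : Tendsto (fun n => ‖y n‖) atTop atTop) :
    Tendsto (fun n => inner ℂ u (evolve 0 (y n) v)) atTop (𝓝 0) := by
  have h1 := tendsto_integral_exp_inner_smul_cocompact
    (fun ξ : E3 => inner ℂ ((𝓕 u : L2) ξ) ((𝓕 v : L2) ξ))
  have h2 := h1.comp (tendsto_cocompact_of_norm h)
  refine h2.congr fun n => ?_
  rw [← Lp.inner_fourier_eq, fourier_evolve, L2.inner_def]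
  refine integral_congr_ae ?_
  filter_upwards [coeFn_phaseMul 0 (y n) (𝓕 v)] with ξ hξ
  rw [hξ, ← smul_eq_mul, inner_smul_right, Circle.smul_def, smul_eq_mul, Real.fourierChar_apply,
    phase]
  congr 3
  simp [real_inner_comm]

/-- Escaping times are handled by L^{4/3}-L⁴ duality and decay in L⁴; for convergent times the
evolution is frozen at the limit and the translation escapes. -/
theorem tendsto_inner_evolve (f : 𝓢(E3, ℂ)) {u : L2} (hu : WeaklyDiff u)
    {s : ℕ → ℝ} {y : ℕ → E3} (h : Tendsto (fun n => |s n| + ‖y n‖) atTop atTop) :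
    Tendsto (fun n => inner ℂ (f.toLp 2 volume) (evolve (s n) (y n) u)) atTop (𝓝 0) := by
  refine tendsto_of_subseq_tendsto fun ns hns => ?_
  obtain ⟨φ, hφ, hs⟩ := exists_subseq_tendsto_or_cocompact (s ∘ ns)
  refine ⟨φ, ?_⟩
  rcases hs with hs | ⟨σ, hs⟩
  · have h1 := (tendsto_toL4_evolve hu).comp hs
    have hfin : eLpNorm f (4 / 3) (volume : Measure E3) ≠ ⊤ :=
      (f.memLp (4 / 3) (volume : Measure E3)).2.ne
    have h2 := h1.const_mul (eLpNorm f (4 / 3) (volume : Measure E3)).toReal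
    rw [mul_zero] at h2
    refine squeeze_zero_norm (fun n => ?_) h2
    have h3 := ofReal_norm_inner_toLp_le (p := 4 / 3) (q := 4) f
      (evolve (s (ns (φ n))) (y (ns (φ n))) u)
    rw [← ofReal_norm_toL4 (hu.evolve _ _), norm_toL4_evolve hu, ← ENNReal.ofReal_toReal hfin,
      ← ENNReal.ofReal_mul ENNReal.toReal_nonneg] at h3
    exact (ENNReal.ofReal_le_ofReal_iff
      (mul_nonneg ENNReal.toReal_nonneg (norm_nonneg _))).1 h3
  · set m : ℕ → ℕ := fun n => ns (φ n) with hm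
    have hmt : Tendsto m atTop atTop := hns.comp hφ.tendsto_atTop
    have hs' : Tendsto (fun n => s (m n)) atTop (𝓝 σ) := hs
    have hy : Tendsto (fun n => ‖y (m n)‖) atTop atTop := by
      refine ((h.comp hmt).atTop_add hs'.abs.neg).congr fun n => ?_
      simp only [Function.comp_apply]
      ring
    have h1 : Tendsto (fun n => ‖evolve (s (m n)) 0 u - evolve σ 0 u‖) atTop (𝓝 0) :=
      tendsto_iff_norm_sub_tendsto_zero.1 (((continuous_evolve u).tendsto σ).comp hs')
    have h2 := tendsto_inner_translate (f.toLp 2 volume) (evolve σ 0 u) hy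
    have h3 := h2.add (squeeze_zero_norm (a := fun n => ‖f.toLp 2 (volume : Measure E3)‖ *
      ‖evolve (s (m n)) 0 u - evolve σ 0 u‖) (f := fun n => inner ℂ (f.toLp 2 volume)
      (evolve 0 (y (m n)) (evolve (s (m n)) 0 u - evolve σ 0 u))) (fun n => by
        refine (norm_inner_le_norm _ _).trans_eq ?_
        rw [LinearIsometry.norm_map]) (by simpa using h1.const_mul _))
    rw [add_zero] at h3
    refine h3.congr fun n => ?_
    rw [← inner_add_right, ← map_add, add_sub_cancel, evolve_evolve, zero_add, add_zero]

/-! ### Asymptotic Pythagoras -/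

section Abstract

variable {ι X H : Type*} [NormedAddCommGroup X] [NormedSpace ℂ X] [NormedAddCommGroup H]
  [InnerProductSpace ℂ H]

theorem tendsto_norm_sq_add {u v : ℕ → H} (h : Tendsto (fun n => inner ℂ (u n) (v n)) atTop (𝓝 0)) :
    Tendsto (fun n => ‖u n + v n‖ ^ 2 - (‖u n‖ ^ 2 + ‖v n‖ ^ 2)) atTop (𝓝 0) := by
  have h1 : Tendsto (fun n => 2 * RCLike.re (inner ℂ (u n) (v n))) atTop (𝓝 0) := by
    simpa using ((RCLike.continuous_re.tendsto _).comp h).const_mul 2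
  refine h1.congr fun n => ?_
  rw [norm_add_sq (𝕜 := ℂ)]
  ring

theorem tendsto_norm_sq_sum {a : ι → ℕ → H} (s : Finset ι)
    (h : ∀ i ∈ s, ∀ j ∈ s, i ≠ j → Tendsto (fun n => inner ℂ (a i n) (a j n)) atTop (𝓝 0)) :
    Tendsto (fun n => ‖∑ i ∈ s, a i n‖ ^ 2 - ∑ i ∈ s, ‖a i n‖ ^ 2) atTop (𝓝 0) := by
  classical
  induction s using Finset.induction_on with
  | empty => simp
  | insert i s hi ih =>
    have h1 : Tendsto (fun n => inner ℂ (a i n) (∑ j ∈ s, a j n)) atTop (𝓝 0) := by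
      simp_rw [inner_sum]
      rw [← Finset.sum_const_zero (s := s)]
      refine tendsto_finsetSum _ fun j hj => h i (Finset.mem_insert_self i s) j
        (Finset.mem_insert_of_mem hj) ?_
      rintro rfl
      exact hi hj
    have h2 := (tendsto_norm_sq_add h1).add (ih fun j hj k hk => h j (Finset.mem_insert_of_mem hj)
      k (Finset.mem_insert_of_mem hk))
    rw [add_zero] at h2
    refine h2.congr fun n => ?_
    rw [Finset.sum_insert hi, Finset.sum_insert hi]
    ring

/-! ### Asymptotic decoupling of a bilinear map -/

theorem abs_norm_sq_sub_norm_sq_le {E : Type*} [NormedAddCommGroup E] (y z : E) :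
    |‖y‖ ^ 2 - ‖z‖ ^ 2| ≤ ‖y - z‖ * (‖y‖ + ‖z‖) := by
  have : ‖y‖ ^ 2 - ‖z‖ ^ 2 = (‖y‖ - ‖z‖) * (‖y‖ + ‖z‖) := by ring
  rw [this, abs_mul, abs_of_nonneg (add_nonneg (norm_nonneg y) (norm_nonneg z))]
  exact mul_le_mul_of_nonneg_right (abs_norm_sub_norm_le y z) (by positivity)

theorem abs_norm_sq_bilinear_sub_le (B : X →L[ℂ] X →L[ℂ] H) {x x' r r' : X} {C δ : ℝ}
    (hx : ‖x‖ ≤ C) (hx' : ‖x'‖ ≤ C) (hr : ‖r‖ ≤ δ) (hr' : ‖r'‖ ≤ δ) (hδ : δ ≤ 1) :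
    |‖B (x + r) (x' + r')‖ ^ 2 - ‖B x x'‖ ^ 2| ≤
      δ * (‖B‖ * (2 * C + 1) * (2 * (‖B‖ * (C + 1) ^ 2))) := by
  have hC : 0 ≤ C := (norm_nonneg x).trans hx
  have hδ0 : 0 ≤ δ := (norm_nonneg r).trans hr
  have e1 : ‖x + r‖ ≤ C + 1 := (norm_add_le _ _).trans (by linarith)
  have e2 : ‖x' + r'‖ ≤ C + 1 := (norm_add_le _ _).trans (by linarith)
  have h1 : ‖B (x + r) (x' + r')‖ ≤ ‖B‖ * (C + 1) ^ 2 := by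
    refine (B.le_opNorm₂ _ _).trans ?_
    rw [mul_assoc, sq]
    gcongr
  have h2 : ‖B x x'‖ ≤ ‖B‖ * (C + 1) ^ 2 := by
    refine (B.le_opNorm₂ _ _).trans ?_
    rw [mul_assoc, sq]
    gcongr <;> linarith
  have hsplit : B (x + r) (x' + r') - B x x' = B (x + r) r' + B r x' := by
    simp only [map_add, add_apply]
    abel
  have h3 : ‖B (x + r) (x' + r') - B x x'‖ ≤ δ * (‖B‖ * (2 * C + 1)) := by
    rw [hsplit]
    calc ‖B (x + r) r' + B r x'‖ ≤ ‖B‖ * (C + 1) * δ + ‖B‖ * δ * C := by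
          refine (norm_add_le _ _).trans (add_le_add ((B.le_opNorm₂ _ _).trans ?_)
            ((B.le_opNorm₂ _ _).trans ?_)) <;> gcongr
      _ = δ * (‖B‖ * (2 * C + 1)) := by ring
  refine (abs_norm_sq_sub_norm_sq_le _ _).trans ?_
  calc ‖B (x + r) (x' + r') - B x x'‖ * (‖B (x + r) (x' + r')‖ + ‖B x x'‖)
      ≤ δ * (‖B‖ * (2 * C + 1)) * (2 * (‖B‖ * (C + 1) ^ 2)) := by
        gcongr
        linarith
    _ = _ := by ring

/-- The off-diagonal part of the expanded product tends to zero in norm, and `hB` with `hc` makes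
the diagonal terms asymptotically orthogonal. -/
theorem tendsto_norm_sq_bilinear_sum (B : X →L[ℂ] X →L[ℂ] H)
    (hB : ∀ a b c d, ‖inner ℂ (B a b) (B c d)‖ ≤ ‖B a d‖ * ‖B c b‖)
    {a a' : ι → ℕ → X} (ha : ∀ j, ∃ C, ∀ n, ‖a j n‖ ≤ C) (ha' : ∀ j, ∃ C, ∀ n, ‖a' j n‖ ≤ C)
    (hc : ∀ j k, j ≠ k → Tendsto (fun n => ‖B (a j n) (a' k n)‖) atTop (𝓝 0)) (s : Finset ι) :
    Tendsto (fun n => ‖B (∑ j ∈ s, a j n) (∑ j ∈ s, a' j n)‖ ^ 2 -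
      ∑ j ∈ s, ‖B (a j n) (a' j n)‖ ^ 2) atTop (𝓝 0) := by
  classical
  have h1 : Tendsto (fun n => ‖∑ j ∈ s, B (a j n) (a' j n)‖ ^ 2 -
      ∑ j ∈ s, ‖B (a j n) (a' j n)‖ ^ 2) atTop (𝓝 0) := by
    refine tendsto_norm_sq_sum s fun i _ j _ hij => ?_
    refine squeeze_zero_norm (fun n => hB _ _ _ _) ?_
    simpa using (hc i j hij).mul (hc j i hij.symm)
  have h2 : Tendsto (fun n => ‖B (∑ j ∈ s, a j n) (∑ j ∈ s, a' j n) -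
      ∑ j ∈ s, B (a j n) (a' j n)‖) atTop (𝓝 0) := by
    have hle : ∀ n, ‖B (∑ j ∈ s, a j n) (∑ j ∈ s, a' j n) - ∑ j ∈ s, B (a j n) (a' j n)‖ ≤
        ∑ j ∈ s, ∑ k ∈ s, if j = k then 0 else ‖B (a j n) (a' k n)‖ := fun n => by
      have e : B (∑ j ∈ s, a j n) (∑ j ∈ s, a' j n) - ∑ j ∈ s, B (a j n) (a' j n) =
          ∑ j ∈ s, ∑ k ∈ s, if j = k then 0 else B (a j n) (a' k n) := by
        rw [map_sum B, sum_apply, ← Finset.sum_sub_distrib]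
        refine Finset.sum_congr rfl fun j hj => ?_
        rw [map_sum, ← Finset.add_sum_erase s _ hj, add_sub_cancel_left,
          ← Finset.add_sum_erase s (fun k => if j = k then 0 else B (a j n) (a' k n)) hj,
          if_pos rfl, zero_add]
        refine Finset.sum_congr rfl fun k hk => ?_
        rw [if_neg (Finset.ne_of_mem_erase hk).symm]
      rw [e]
      refine (norm_sum_le _ _).trans (Finset.sum_le_sum fun j _ => (norm_sum_le _ _).trans
        (Finset.sum_le_sum fun k _ => ?_))
      split_ifs <;> simp
    refine squeeze_zero (fun _ => norm_nonneg _) hle ?_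
    have hz : (0 : ℝ) = ∑ j ∈ s, ∑ k ∈ s, 0 := by simp
    rw [hz]
    refine tendsto_finsetSum _ fun j _ => tendsto_finsetSum _ fun k _ => ?_
    by_cases hjk : j = k
    · simp [hjk]
    · simpa [hjk] using hc j k hjk
  choose C hC using ha
  choose C' hC' using ha'
  have h3 : Tendsto (fun n => ‖B (∑ j ∈ s, a j n) (∑ j ∈ s, a' j n)‖ ^ 2 -
      ‖∑ j ∈ s, B (a j n) (a' j n)‖ ^ 2) atTop (𝓝 0) := by
    have hb1 : ∀ n, ‖B (∑ j ∈ s, a j n) (∑ j ∈ s, a' j n)‖ ≤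
        ‖B‖ * (∑ j ∈ s, C j) * (∑ j ∈ s, C' j) := fun n => by
      have i1 : ‖∑ j ∈ s, a j n‖ ≤ ∑ j ∈ s, C j :=
        (norm_sum_le _ _).trans (Finset.sum_le_sum fun j _ => hC j n)
      have i2 : ‖∑ j ∈ s, a' j n‖ ≤ ∑ j ∈ s, C' j :=
        (norm_sum_le _ _).trans (Finset.sum_le_sum fun j _ => hC' j n)
      have i3 : 0 ≤ ∑ j ∈ s, C j := (norm_nonneg _).trans i1
      refine (B.le_opNorm₂ _ _).trans ?_
      gcongr
    have hb2 : ∀ n, ‖∑ j ∈ s, B (a j n) (a' j n)‖ ≤ ∑ j ∈ s, ‖B‖ * C j * C' j := fun n => by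
      refine (norm_sum_le _ _).trans (Finset.sum_le_sum fun j _ => ?_)
      have i3 : 0 ≤ C j := (norm_nonneg _).trans (hC j n)
      refine (B.le_opNorm₂ _ _).trans ?_
      gcongr
      · exact hC j n
      · exact hC' j n
    have h5 := h2.mul_const (‖B‖ * (∑ j ∈ s, C j) * (∑ j ∈ s, C' j) + (∑ j ∈ s, ‖B‖ * C j * C' j))
    rw [zero_mul] at h5
    refine squeeze_zero_norm (fun n => ?_) h5
    refine (abs_norm_sq_sub_norm_sq_le _ _).trans ?_
    exact mul_le_mul_of_nonneg_left (add_le_add (hb1 n) (hb2 n)) (norm_nonneg _)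
  have h4 := h3.add h1
  rw [add_zero] at h4
  refine h4.congr fun n => ?_
  ring

/-- For a late N, `φ` is nearly the sum of the profiles below N and `w M` nearly the sum from M to
N. The finite-sum result applies to both, and the diagonal sums subtract to the one below M. -/
theorem tendsto_norm_sq_bilinear_decomposition (B : X →L[ℂ] X →L[ℂ] H)
    (hB : ∀ a b c d, ‖inner ℂ (B a b) (B c d)‖ ≤ ‖B a d‖ * ‖B c b‖)
    {a a' : ℕ → ℕ → X} (ha : ∀ j, ∃ C, ∀ n, ‖a j n‖ ≤ C) (ha' : ∀ j, ∃ C, ∀ n, ‖a' j n‖ ≤ C)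
    (hc : ∀ j k, j ≠ k → Tendsto (fun n => ‖B (a j n) (a' k n)‖) atTop (𝓝 0))
    {φ φ' : ℕ → X} {w w' : ℕ → ℕ → X}
    (hφ : ∀ M n, φ n = ∑ j ∈ Finset.range M, a j n + w M n)
    (hφ' : ∀ M n, φ' n = ∑ j ∈ Finset.range M, a' j n + w' M n)
    (hb : ∃ C, ∀ n, ‖φ n‖ ≤ C) (hb' : ∃ C, ∀ n, ‖φ' n‖ ≤ C)
    (hw : ∀ ε > 0, ∀ᶠ M in atTop, ∀ᶠ n in atTop, ‖w M n‖ ≤ ε)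
    (hw' : ∀ ε > 0, ∀ᶠ M in atTop, ∀ᶠ n in atTop, ‖w' M n‖ ≤ ε) (M : ℕ) :
    Tendsto (fun n => ‖B (φ n) (φ' n)‖ ^ 2 - (∑ j ∈ Finset.range M, ‖B (a j n) (a' j n)‖ ^ 2 +
      ‖B (w M n) (w' M n)‖ ^ 2)) atTop (𝓝 0) := by
  obtain ⟨C₀, hC₀⟩ := hb
  obtain ⟨C₁, hC₁⟩ := hb'
  choose D hD using ha
  choose D' hD' using ha'
  have hwM : ∀ n, ‖w M n‖ ≤ C₀ + ∑ j ∈ Finset.range M, D j := fun n => by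
    rw [← sub_eq_iff_eq_add'.2 (hφ M n)]
    exact (norm_sub_le _ _).trans (add_le_add (hC₀ n)
      ((norm_sum_le _ _).trans (Finset.sum_le_sum fun j _ => hD j n)))
  have hwM' : ∀ n, ‖w' M n‖ ≤ C₁ + ∑ j ∈ Finset.range M, D' j := fun n => by
    rw [← sub_eq_iff_eq_add'.2 (hφ' M n)]
    exact (norm_sub_le _ _).trans (add_le_add (hC₁ n)
      ((norm_sum_le _ _).trans (Finset.sum_le_sum fun j _ => hD' j n)))
  set C : ℝ := max (max C₀ C₁) (max (C₀ + ∑ j ∈ Finset.range M, D j)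
    (C₁ + ∑ j ∈ Finset.range M, D' j)) with hCdef
  have hCnn : 0 ≤ C := (norm_nonneg _).trans ((hC₀ 0).trans ((le_max_left _ _).trans
    (le_max_left _ _)))
  -- The perturbation constant with C + 1 in place of C. A profile sum is a bounded sequence minus a
  -- remainder of norm at most 1, so this bound, and with it δ, does not depend on N, which is
  -- chosen afterwards.
  set K : ℝ := ‖B‖ * (2 * (C + 1) + 1) * (2 * (‖B‖ * (C + 1 + 1) ^ 2)) with hK
  have hK0 : 0 ≤ K := by positivity
  rw [Metric.tendsto_nhds]
  intro ε hε
  set δ : ℝ := min 1 (ε / (4 * (K + 1))) with hδdef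
  have hδ : 0 < δ := lt_min one_pos (by positivity)
  have hδK : δ * K ≤ ε / 4 := by
    have : δ * (4 * (K + 1)) ≤ ε := by
      rw [← le_div_iff₀ (by positivity)]
      exact min_le_right _ _
    nlinarith
  obtain ⟨N, hN, hN', hMN⟩ := ((hw δ hδ).and ((hw' δ hδ).and (eventually_ge_atTop M))).exists
  have hs1 := tendsto_norm_sq_bilinear_sum B hB (fun j => ⟨D j, hD j⟩) (fun j => ⟨D' j, hD' j⟩) hc
    (Finset.range N)
  have hs2 := tendsto_norm_sq_bilinear_sum B hB (fun j => ⟨D j, hD j⟩) (fun j => ⟨D' j, hD' j⟩) hc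
    (Finset.Ico M N)
  rw [Metric.tendsto_nhds] at hs1 hs2
  filter_upwards [hN, hN', hs1 (ε / 4) (by positivity), hs2 (ε / 4) (by positivity)]
    with n h1 h2 h3 h4
  rw [Real.dist_eq, sub_zero] at h3 h4 ⊢
  have hsum := fun u : ℕ → ℕ → X => Finset.sum_range_add_sum_Ico (fun j => u j n) hMN
  have hsplit : w M n = ∑ j ∈ Finset.Ico M N, a j n + w N n := by
    have e1 := hφ M n
    rw [hφ N n, ← hsum a, add_assoc] at e1
    exact (add_left_cancel e1).symm
  have hsplit' : w' M n = ∑ j ∈ Finset.Ico M N, a' j n + w' N n := by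
    have e1 := hφ' M n
    rw [hφ' N n, ← hsum a', add_assoc] at e1
    exact (add_left_cancel e1).symm
  have hδ1 : δ ≤ 1 := min_le_left _ _
  have bound : ∀ {x r y : X}, y = x + r → ‖y‖ ≤ C → ‖r‖ ≤ δ → ‖x‖ ≤ C + 1 := by
    intro x r y hy hyC hr
    have : x = y - r := by rw [hy, add_sub_cancel_right]
    rw [this]
    exact (norm_sub_le _ _).trans (by linarith)
  have c1 := abs_norm_sq_bilinear_sub_le B
    (bound (hφ N n) ((hC₀ n).trans ((le_max_left _ _).trans (le_max_left _ _))) h1)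
    (bound (hφ' N n) ((hC₁ n).trans ((le_max_right _ _).trans (le_max_left _ _))) h2) h1 h2 hδ1
  have c2 := abs_norm_sq_bilinear_sub_le B
    (bound hsplit ((hwM n).trans ((le_max_left _ _).trans (le_max_right _ _))) h1)
    (bound hsplit' ((hwM' n).trans ((le_max_right _ _).trans (le_max_right _ _))) h2) h1 h2 hδ1
  rw [← hφ N n, ← hφ' N n] at c1
  rw [← hsplit, ← hsplit'] at c2
  rw [← hK] at c1 c2
  have hq := Finset.sum_range_add_sum_Ico (fun j => ‖B (a j n) (a' j n)‖ ^ 2) hMN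
  rw [abs_le] at c1 c2
  rw [abs_lt] at h3 h4 ⊢
  constructor <;> linarith

end Abstract

/-! ### The endpoint `L^∞_t L^3_x` of the Strichartz norm -/

theorem eLpNorm_evolve_eq (s : ℝ) (y : E3) (u : L2) (p : ℝ≥0∞) :
    eLpNorm (evolve s y u) p volume = eLpNorm (evolve s 0 u) p volume := by
  rw [evolve_eq_translate, translate,
    eLpNorm_congr_ae (Lp.coeFn_compMeasurePreserving _ (measurePreserving_sub_right volume y))]
  exact eLpNorm_comp_measurePreserving (Lp.aestronglyMeasurable _)
    (measurePreserving_sub_right volume y)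

/-- The pair (∞, 3) controls almost every time only. Such times are dense, and strong L² continuity
with lower semicontinuity extends the bound to every time, as is needed at the prescribed times
t_n^j. -/
theorem eLpNorm_three_evolve_le {r₀ : ℝ≥0∞} (hr₀ : 3 ≤ r₀) (u : L2) (s : ℝ) (y : E3) :
    eLpNorm (evolve s y u) 3 volume ≤ strichartzNorm r₀ (fun s => schrodinger s u) := by
  have h1 : mixedNorm ⊤ 3 (fun s => schrodinger s u) ≤
      strichartzNorm r₀ (fun s => schrodinger s u) := by
    refine le_iSup₂_of_le ⊤ 3 (le_iSup_of_le ⟨?_, le_rfl, hr₀⟩ le_rfl)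
    rw [ENNReal.div_top, zero_add, ENNReal.div_self (by simp) (by simp)]
  rw [eLpNorm_evolve_eq]
  refine le_trans ?_ h1
  set S := mixedNorm ⊤ 3 (fun s => schrodinger s u)
  have hae : ∀ᵐ t : ℝ, eLpNorm (evolve t 0 u) 3 volume ≤ S := by
    have h2 := ae_le_eLpNormEssSup (f := fun t : ℝ => eLpNorm (schrodinger t u) 3
      (volume : Measure E3)) (μ := volume)
    filter_upwards [h2] with t ht
    rw [← schrodinger_eq_evolve]
    simpa [S, mixedNorm, eLpNorm_exponent_top] using ht
  obtain ⟨τ, hτ, hlim⟩ := mem_closure_iff_seq_limit.1 ((Measure.dense_of_ae hae) s)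
  exact eLpNorm_le_of_tendsto (((continuous_evolve u).tendsto s).comp hlim)
    (Eventually.of_forall hτ)

/-! ### Weak convergence of derivatives -/

/-- Integration by parts: the symbol 2πiξ_k is purely imaginary. -/
theorem IsWeakPartial.inner_eq_neg {k : Fin 3} {u u' v v' : L2} (hu : IsWeakPartial k u u')
    (hv : IsWeakPartial k v v') : inner ℂ u v' = -inner ℂ u' v := by
  rw [← Lp.inner_fourier_eq u v', ← Lp.inner_fourier_eq u' v, L2.inner_def, L2.inner_def, ← integral_neg]
  rw [isWeakPartial_iff] at hu hv
  refine integral_congr_ae ?_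
  filter_upwards [hu, hv] with ξ h1 h2
  rw [h1, h2]
  simp only [RCLike.inner_apply, map_mul, Complex.conj_ofReal, Complex.conj_I, map_ofNat]
  ring

/-- Against a Schwartz function the derivative is moved onto it; the bound on the derivatives
extends the limit to all of L² by density. -/
theorem tendsto_inner_weakPartial {k : Fin 3} {V : ℕ → L2} (hV : ∀ n, WeaklyDiff (V n))
    (hb : ∃ C, ∀ n, ‖weakPartial k (V n)‖ ≤ C)
    (hw : ∀ f : 𝓢(E3, ℂ), Tendsto (fun n => inner ℂ (f.toLp 2 volume) (V n)) atTop (𝓝 0))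
    (g : L2) : Tendsto (fun n => inner ℂ g (weakPartial k (V n))) atTop (𝓝 0) := by
  obtain ⟨C, hC⟩ := hb
  have hC0 : 0 ≤ C := (norm_nonneg _).trans (hC 0)
  rw [Metric.tendsto_nhds]
  intro ε hε
  have hd := SchwartzMap.denseRange_toLpCLM (E := E3) (F := ℂ) (p := 2) (μ := volume)
    ENNReal.ofNat_ne_top
  have hδ : 0 < ε / (2 * (C + 1)) := by positivity
  obtain ⟨f, hf⟩ := hd.exists_dist_lt g hδ
  rw [dist_eq_norm, SchwartzMap.toLpCLM_apply] at hf
  have h1 := hw (∂_{(EuclideanSpace.single k (1 : ℝ) : E3)} f)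
  rw [Metric.tendsto_nhds] at h1
  filter_upwards [h1 (ε / 2) (half_pos hε)] with n hn
  rw [dist_zero_right] at hn ⊢
  have e : inner ℂ g (weakPartial k (V n)) =
      inner ℂ (g - f.toLp 2 volume) (weakPartial k (V n)) -
        inner ℂ ((∂_{(EuclideanSpace.single k (1 : ℝ) : E3)} f).toLp 2 volume) (V n) := by
    rw [inner_sub_left, (isWeakPartial_toLp k f).inner_eq_neg (hV n k)]
    ring
  rw [e]
  have h2 : ‖inner ℂ (g - f.toLp 2 volume) (weakPartial k (V n))‖ ≤ ε / 2 := by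
    calc _ ≤ ‖g - f.toLp 2 volume‖ * ‖weakPartial k (V n)‖ := norm_inner_le_norm _ _
      _ ≤ ε / (2 * (C + 1)) * (C + 1) := by
          gcongr
          linarith [hC n]
      _ = ε / 2 := by field_simp
  exact (norm_sub_le _ _).trans_lt (by linarith)

/-! ### Profile decompositions of a single sequence -/

/-- The linearly evolved profiles `e^{-it_n^jΔ}ψ^j(· - x_n^j)` and the remainders decompose a
sequence that is bounded in `Ḣ¹`, and the remainders vanish in `L^∞_t L^3_x`. -/
structure SingleDecomposition (φ ψ : ℕ → L2) (t : ℕ → ℕ → ℝ) (x : ℕ → ℕ → E3)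
    (W : ℕ → ℕ → L2) : Prop where
  weaklyDiff : ∀ n, WeaklyDiff (φ n)
  bounded : ∃ C, ∀ n, h1Size (φ n) ≤ C
  profile : ∀ j, WeaklyDiff (ψ j)
  remainder : ∀ M, 1 ≤ M → ∀ n, WeaklyDiff (W M n)
  decomposition : ∀ M, 1 ≤ M → ∀ n,
    φ n = ∑ j ∈ Finset.range M, evolve (-t j n) (x j n) (ψ j) + W M n
  orthogonality : ∀ j k, j ≠ k →
    Tendsto (fun n => |t j n - t k n| + ‖x j n - x k n‖) atTop atTop
  vanishing : ∀ ε : ℝ, 0 < ε → ∀ᶠ M in atTop, ∀ᶠ n in atTop, ∀ s y,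
    eLpNorm (evolve s y (W M n)) 3 volume ≤ ENNReal.ofReal ε

namespace SingleDecomposition

variable {φ ψ : ℕ → L2} {t : ℕ → ℕ → ℝ} {x : ℕ → ℕ → E3} {W : ℕ → ℕ → L2}

theorem tendsto_inner_profile (h : SingleDecomposition φ ψ t x W) {j k : ℕ} (hjk : j ≠ k)
    (f : 𝓢(E3, ℂ)) :
    Tendsto (fun n => inner ℂ (f.toLp 2 volume)
      (evolve (t j n) (-x j n) (evolve (-t k n) (x k n) (ψ k)))) atTop (𝓝 0) := by
  simp_rw [evolve_evolve]
  refine tendsto_inner_evolve f (h.profile k) ?_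
  refine (h.orthogonality j k hjk).congr fun n => ?_
  rw [← sub_eq_add_neg, ← norm_neg (-x j n + x k n)]
  congr 2
  abel

theorem remainder_eq (h : SingleDecomposition φ ψ t x W) {M N : ℕ} (hM : 1 ≤ M) (hMN : M ≤ N)
    (n : ℕ) : W M n = ∑ j ∈ Finset.Ico M N, evolve (-t j n) (x j n) (ψ j) + W N n := by
  have e1 := h.decomposition M hM n
  rw [h.decomposition N (hM.trans hMN) n, ← Finset.sum_range_add_sum_Ico _ hMN, add_assoc] at e1
  exact (add_left_cancel e1).symm

/-- The profiles from M to N differ in index from `j` and so vanish weakly; the rest is small by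
L^{3/2}-L³ duality, since the bound on `W N` is uniform over times and shifts. -/
theorem tendsto_inner_remainder (h : SingleDecomposition φ ψ t x W) {M : ℕ} (hM : 1 ≤ M) {j : ℕ}
    (hj : j < M) (f : 𝓢(E3, ℂ)) :
    Tendsto (fun n => inner ℂ (f.toLp 2 volume) (evolve (t j n) (-x j n) (W M n))) atTop
      (𝓝 0) := by
  have hfin : eLpNorm f (3 / 2) (volume : Measure E3) ≠ ⊤ :=
    (f.memLp (3 / 2) (volume : Measure E3)).2.ne
  set F : ℝ := (eLpNorm f (3 / 2) (volume : Measure E3)).toReal with hF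
  have hF0 : 0 ≤ F := ENNReal.toReal_nonneg
  rw [Metric.tendsto_nhds]
  intro ε hε
  have hδ : 0 < ε / (2 * (F + 1)) := by positivity
  obtain ⟨N, hN, hMN⟩ := ((h.vanishing _ hδ).and (eventually_ge_atTop M)).exists
  have h1 : Tendsto (fun n => ∑ k ∈ Finset.Ico M N, inner ℂ (f.toLp 2 (volume : Measure E3))
      (evolve (t j n) (-x j n) (evolve (-t k n) (x k n) (ψ k)))) atTop (𝓝 0) := by
    have h2 := tendsto_finsetSum (Finset.Ico M N) fun k hk =>
      h.tendsto_inner_profile (hj.trans_le (Finset.mem_Ico.1 hk).1).ne f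
    rwa [Finset.sum_const_zero] at h2
  rw [Metric.tendsto_nhds] at h1
  filter_upwards [hN, h1 (ε / 2) (half_pos hε)] with n h2 h3
  rw [dist_zero_right] at h3 ⊢
  rw [h.remainder_eq hM hMN n, map_add, map_sum, inner_add_right, inner_sum]
  have h4 := ofReal_norm_inner_toLp_le (p := 3 / 2) (q := 3) f (evolve (t j n) (-x j n) (W N n))
  have h5 := h4.trans (mul_le_mul_of_nonneg_left (h2 (t j n) (-x j n)) zero_le)
  rw [← ENNReal.ofReal_toReal hfin, ← ENNReal.ofReal_mul hF0] at h5
  have h6 := (ENNReal.ofReal_le_ofReal_iff (mul_nonneg hF0 hδ.le)).1 h5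
  have h7 : F * (ε / (2 * (F + 1))) ≤ ε / 2 := by
    calc F * (ε / (2 * (F + 1))) ≤ (F + 1) * (ε / (2 * (F + 1))) := by gcongr; linarith
      _ = ε / 2 := by field_simp
  exact (norm_add_le _ _).trans_lt (by linarith)

theorem weakPartial_remainder (h : SingleDecomposition φ ψ t x W) {M : ℕ} (hM : 1 ≤ M) (n : ℕ)
    (k : Fin 3) : weakPartial k (φ n) = ∑ j ∈ Finset.range M,
      evolve (-t j n) (x j n) (weakPartial k (ψ j)) + weakPartial k (W M n) := by
  refine IsWeakPartial.weakPartial_eq ?_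
  rw [h.decomposition M hM n]
  exact (IsWeakPartial.sum fun j _ => (h.profile j k).evolve _ _).add (h.remainder M hM n k)

theorem exists_norm_weakPartial_remainder_le (h : SingleDecomposition φ ψ t x W) {M : ℕ}
    (hM : 1 ≤ M) (k : Fin 3) : ∃ C, ∀ n, ‖weakPartial k (W M n)‖ ≤ C := by
  obtain ⟨C, hC⟩ := h.bounded
  refine ⟨C + ∑ j ∈ Finset.range M, ‖weakPartial k (ψ j)‖, fun n => ?_⟩
  rw [← sub_eq_iff_eq_add'.2 (h.weakPartial_remainder hM n k)]
  refine (norm_sub_le _ _).trans (add_le_add ?_ ((norm_sum_le _ _).trans (le_of_eq ?_)))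
  · refine le_trans ?_ (hC n)
    have := Finset.single_le_sum (f := fun k => ‖weakPartial k (φ n)‖)
      (fun k _ => norm_nonneg _) (Finset.mem_univ k)
    unfold h1Size
    linarith [norm_nonneg (φ n)]
  · simp only [LinearIsometry.norm_map]

theorem tendsto_norm_sq_weakPartial (h : SingleDecomposition φ ψ t x W) {M : ℕ} (hM : 1 ≤ M)
    (k : Fin 3) :
    Tendsto (fun n => ‖weakPartial k (φ n)‖ ^ 2 - (∑ j ∈ Finset.range M,
      ‖weakPartial k (evolve (-t j n) (x j n) (ψ j))‖ ^ 2 + ‖weakPartial k (W M n)‖ ^ 2))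
      atTop (𝓝 0) := by
  set a : ℕ → ℕ → L2 := fun j n => evolve (-t j n) (x j n) (weakPartial k (ψ j)) with ha
  have hpp : ∀ i ∈ Finset.range M, ∀ j ∈ Finset.range M, i ≠ j →
      Tendsto (fun n => inner ℂ (a i n) (a j n)) atTop (𝓝 0) := fun i _ j _ hij => by
    have h1 := tendsto_inner_weakPartial (k := k)
      (V := fun n => evolve (t i n) (-x i n) (evolve (-t j n) (x j n) (ψ j)))
      (fun n => ((h.profile j).evolve _ _).evolve _ _)
      ⟨‖weakPartial k (ψ j)‖, fun n => by
        rw [((h.profile j).evolve _ _).weakPartial_evolve, (h.profile j).weakPartial_evolve,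
          LinearIsometry.norm_map, LinearIsometry.norm_map]⟩
      (fun f => h.tendsto_inner_profile hij f) (weakPartial k (ψ i))
    refine h1.congr fun n => ?_
    rw [((h.profile j).evolve _ _).weakPartial_evolve, (h.profile j).weakPartial_evolve,
      inner_evolve_right, neg_neg]
  have hpw : ∀ j ∈ Finset.range M, Tendsto (fun n => inner ℂ (a j n) (weakPartial k (W M n)))
      atTop (𝓝 0) := fun j hj => by
    obtain ⟨C, hC⟩ := h.exists_norm_weakPartial_remainder_le hM k
    have h1 := tendsto_inner_weakPartial (k := k)
      (V := fun n => evolve (t j n) (-x j n) (W M n))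
      (fun n => (h.remainder M hM n).evolve _ _)
      ⟨C, fun n => by
        rw [(h.remainder M hM n).weakPartial_evolve, LinearIsometry.norm_map]
        exact hC n⟩
      (fun f => h.tendsto_inner_remainder hM (Finset.mem_range.1 hj) f) (weakPartial k (ψ j))
    refine h1.congr fun n => ?_
    rw [(h.remainder M hM n).weakPartial_evolve, inner_evolve_right, neg_neg]
  have h2 := tendsto_norm_sq_sum (Finset.range M) hpp
  have h3 : Tendsto (fun n => inner ℂ (∑ j ∈ Finset.range M, a j n) (weakPartial k (W M n)))
      atTop (𝓝 0) := by
    simp_rw [sum_inner]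
    rw [← Finset.sum_const_zero (s := Finset.range M)]
    exact tendsto_finsetSum _ hpw
  have h4 := (tendsto_norm_sq_add h3).add h2
  rw [add_zero] at h4
  refine h4.congr fun n => ?_
  rw [h.weakPartial_remainder hM n k]
  simp only [(h.profile _).weakPartial_evolve]
  ring

/-- Pythagoras bounds the remainder by the whole sequence. The constant is independent of `M`; only
the threshold in `n` depends on it. -/
theorem exists_eventually_h1_le (h : SingleDecomposition φ ψ t x W) :
    ∃ C, ∀ M, 1 ≤ M → ∀ᶠ n in atTop, ∑ k, ‖weakPartial k (W M n)‖ ≤ C := by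
  obtain ⟨C, hC⟩ := h.bounded
  have hC0 : 0 ≤ C := (h1Size_nonneg _).trans (hC 0)
  refine ⟨3 * (C + 1), fun M hM => ?_⟩
  have hk : ∀ k, ∀ᶠ n in atTop, ‖weakPartial k (W M n)‖ ≤ C + 1 := fun k => by
    filter_upwards [(h.tendsto_norm_sq_weakPartial hM k).eventually_const_lt
      (show (-1 : ℝ) < 0 by norm_num)] with n hn
    have h1 : ‖weakPartial k (φ n)‖ ≤ C := by
      refine le_trans ?_ (hC n)
      have := Finset.single_le_sum (f := fun k => ‖weakPartial k (φ n)‖)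
        (fun k _ => norm_nonneg _) (Finset.mem_univ k)
      unfold h1Size
      linarith [norm_nonneg (φ n)]
    have h2 : 0 ≤ ∑ j ∈ Finset.range M, ‖weakPartial k (evolve (-t j n) (x j n) (ψ j))‖ ^ 2 := by
      positivity
    have h3 : ‖weakPartial k (φ n)‖ ^ 2 ≤ C ^ 2 := by gcongr
    -- The squared norm is below C² + 1, hence below (C + 1)².
    exact (abs_le_of_sq_le_sq' (by nlinarith) (by linarith)).2
  filter_upwards [eventually_all.2 hk] with n hn
  rw [Fin.sum_univ_three]
  linarith [hn 0, hn 1, hn 2]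

theorem eventually_norm_toL4_le (h : SingleDecomposition φ ψ t x W) {ε : ℝ} (hε : 0 < ε) :
    ∀ᶠ M in atTop, ∀ hM : 1 ≤ M, ∀ᶠ n in atTop, ‖toL4 (h.remainder M hM n)‖ ≤ ε := by
  obtain ⟨C, hC⟩ := h.exists_eventually_h1_le
  have hK : 0 ≤ sobolevConst * max C 0 := by positivity
  set K : ℝ := sobolevConst * max C 0
  have hδ : 0 < ε ^ 2 / (K + 1) := by positivity
  filter_upwards [h.vanishing _ hδ] with M hV hM
  filter_upwards [hV, hC M hM] with n h1 h2
  have h3 := eLpNorm_four_sq_le (W M n)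
  have h4 : eLpNorm (W M n) 3 volume ≤ ENNReal.ofReal (ε ^ 2 / (K + 1)) := by
    simpa only [evolve_zero] using h1 0 0
  have h5 : eLpNorm (W M n) 6 volume ≤ ENNReal.ofReal K := by
    refine (eLpNorm_six_le (h.remainder M hM n)).trans (ENNReal.ofReal_le_ofReal ?_)
    exact mul_le_mul_of_nonneg_left (h2.trans (le_max_left _ _)) (by positivity)
  have h6 := h3.trans (mul_le_mul' h4 h5)
  rw [← ofReal_norm_toL4 (h.remainder M hM n), ← ENNReal.ofReal_pow (norm_nonneg _),
    ← ENNReal.ofReal_mul hδ.le] at h6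
  have h7 := (ENNReal.ofReal_le_ofReal_iff (mul_nonneg hδ.le hK)).1 h6
  have h8 : ε ^ 2 / (K + 1) * K ≤ ε ^ 2 := by
    rw [div_mul_eq_mul_div, div_le_iff₀ (by positivity)]
    nlinarith [sq_nonneg ε]
  exact (abs_le_of_sq_le_sq' (h7.trans h8) hε.le).2

end SingleDecomposition

/-! ### Decoupling of the energy -/

theorem integral_norm_mul_sq {u v : L2} (hu : WeaklyDiff u) (hv : WeaklyDiff v) :
    ∫ y, ‖u y * v y‖ ^ 2 = ‖mulL4 (toL4 hu) (toL4 hv)‖ ^ 2 := by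
  rw [norm_sq_eq_integral]
  refine integral_congr_ae ?_
  filter_upwards [coeFn_mulL4 (toL4 hu) (toL4 hv), coeFn_toL4 hu, coeFn_toL4 hv] with x h1 h2 h3
  rw [h1, h2, h3]

theorem integrable_norm_mul_sq {u v : L2} (hu : WeaklyDiff u) (hv : WeaklyDiff v) :
    Integrable fun y => ‖u y * v y‖ ^ 2 := by
  refine (integrable_norm_sq (mulL4 (toL4 hu) (toL4 hv))).congr ?_
  filter_upwards [coeFn_mulL4 (toL4 hu) (toL4 hv), coeFn_toL4 hu, coeFn_toL4 hv] with x h1 h2 h3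
  rw [h1, h2, h3]

theorem integrable_gradSq (u : L2) : Integrable (gradSq u) :=
  integrable_finsetSum _ fun k _ => integrable_norm_sq (weakPartial k u)

theorem integral_gradSq (u : L2) : ∫ x, gradSq u x = ∑ k, ‖weakPartial k u‖ ^ 2 := by
  simp only [gradSq]
  rw [integral_finsetSum _ fun k _ => integrable_norm_sq (weakPartial k u)]
  simp_rw [norm_sq_eq_integral]

theorem energy_eq (β : ℝ) {u v : L2} (hu : WeaklyDiff u) (hv : WeaklyDiff v) :
    energy β u v = (1 / 2) * (∑ k, ‖weakPartial k u‖ ^ 2 + ∑ k, ‖weakPartial k v‖ ^ 2) -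
      (1 / 4) * ((∫ y, ‖u y * u y‖ ^ 2) + 2 * β * (∫ y, ‖u y * v y‖ ^ 2) +
        ∫ y, ‖v y * v y‖ ^ 2) := by
  have e : ∀ y : E3, ‖u y‖ ^ 4 + 2 * β * ‖u y * v y‖ ^ 2 + ‖v y‖ ^ 4 =
      (‖u y * u y‖ ^ 2 + 2 * β * ‖u y * v y‖ ^ 2) + ‖v y * v y‖ ^ 2 := fun y => by
    simp only [norm_mul]
    ring
  have i1 := integrable_norm_mul_sq hu hu
  have i2 := (integrable_norm_mul_sq hu hv).const_mul (2 * β)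
  have i3 := integrable_norm_mul_sq hv hv
  unfold energy
  rw [integral_add (integrable_gradSq u) (integrable_gradSq v), integral_gradSq, integral_gradSq]
  simp_rw [e]
  have e2 := integral_add (i1.add i2) i3
  simp only [Pi.add_apply] at e2
  rw [e2, integral_add i1 i2, integral_const_mul]

theorem toL4_zero : toL4 (u := 0) (fun k => by
    rw [(isWeakPartial_zero k).weakPartial_eq]
    exact isWeakPartial_zero k) = 0 := by
  ext1
  filter_upwards [coeFn_toL4 (u := 0) (fun k => by
    rw [(isWeakPartial_zero k).weakPartial_eq]
    exact isWeakPartial_zero k), Lp.coeFn_zero ℂ 2 (volume : Measure E3),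
    Lp.coeFn_zero ℂ 4 (volume : Measure E3)] with x h1 h2 h3
  rw [h1, h2, h3]

theorem toL4_sum {ι : Type*} {s : Finset ι} {u : ι → L2} (h : ∀ i, WeaklyDiff (u i)) :
    toL4 (WeaklyDiff.sum fun i (_ : i ∈ s) => h i) = ∑ i ∈ s, toL4 (h i) := by
  classical
  induction s using Finset.induction_on with
  | empty => exact toL4_zero
  | insert i s hi ih =>
    have e := Finset.sum_insert (f := fun i => toL4 (h i)) hi
    rw [e, ← ih, ← toL4_add]
    exact toL4_congr _ _ (Finset.sum_insert hi)

theorem h1Size_le (u : L2) : h1Size u ≤ 4 * h1Norm u := by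
  have hs : ∀ a : ℝ, 0 ≤ a → a ^ 2 ≤ ‖u‖ ^ 2 + ∑ k, ‖weakPartial k u‖ ^ 2 → a ≤ h1Norm u :=
    fun _ _ h => Real.le_sqrt_of_sq_le h
  have h0 := hs ‖u‖ (norm_nonneg _) (le_add_of_nonneg_right (by positivity))
  have hk : ∀ k, ‖weakPartial k u‖ ≤ h1Norm u := fun k => hs _ (norm_nonneg _) (by
    have := Finset.single_le_sum (f := fun k => ‖weakPartial k u‖ ^ 2)
      (fun k _ => sq_nonneg _) (Finset.mem_univ k)
    linarith [sq_nonneg ‖u‖])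
  rw [h1Size, Fin.sum_univ_three]
  linarith [hk 0, hk 1, hk 2]

theorem SingleDecomposition.tendsto_integral_norm_mul_sq {φ φ' ψ ψ' : ℕ → L2} {t : ℕ → ℕ → ℝ}
    {x : ℕ → ℕ → E3} {W W' : ℕ → ℕ → L2} (h : SingleDecomposition φ ψ t x W)
    (h' : SingleDecomposition φ' ψ' t x W') {M : ℕ} (hM : 1 ≤ M) :
    Tendsto (fun n => (∫ y, ‖φ n y * φ' n y‖ ^ 2) - (∑ j ∈ Finset.range M,
      (∫ y, ‖evolve (-t j n) (x j n) (ψ j) y * evolve (-t j n) (x j n) (ψ' j) y‖ ^ 2) +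
        ∫ y, ‖W M n y * W' M n y‖ ^ 2)) atTop (𝓝 0) := by
  have hdec : ∀ {φ ψ : ℕ → L2} {W : ℕ → ℕ → L2} (h : SingleDecomposition φ ψ t x W) {N : ℕ}
      (hN : 1 ≤ N) (n : ℕ), toL4 (h.weaklyDiff n) = ∑ j ∈ Finset.range N,
        toL4 ((h.profile j).evolve (-t j n) (x j n)) + toL4 (h.remainder N hN n) := by
    intro φ ψ W h N hN n
    rw [← toL4_sum fun j => (h.profile j).evolve (-t j n) (x j n), ← toL4_add]
    exact toL4_congr _ _ (h.decomposition N hN n)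
  have hprof : ∀ {φ ψ : ℕ → L2} {W : ℕ → ℕ → L2} (h : SingleDecomposition φ ψ t x W) (j : ℕ),
      ∃ C, ∀ n, ‖toL4 ((h.profile j).evolve (-t j n) (x j n))‖ ≤ C := fun h j =>
    ⟨_, fun n => (norm_toL4_le _).trans_eq (by rw [h1Size_evolve (h.profile j)])⟩
  have hbd : ∀ {φ ψ : ℕ → L2} {W : ℕ → ℕ → L2} (h : SingleDecomposition φ ψ t x W),
      ∃ C, ∀ n, ‖toL4 (h.weaklyDiff n)‖ ≤ C := fun h => by
    obtain ⟨C, hC⟩ := h.bounded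
    exact ⟨(1 + sobolevConst) * C, fun n => (norm_toL4_le _).trans
      (mul_le_mul_of_nonneg_left (hC n) (by positivity))⟩
  have hvan : ∀ {φ ψ : ℕ → L2} {W : ℕ → ℕ → L2} (h : SingleDecomposition φ ψ t x W),
      ∀ ε > 0, ∀ᶠ N in atTop, ∀ᶠ n in atTop, ‖toL4 (h.weaklyDiff n) - ∑ j ∈ Finset.range N,
        toL4 ((h.profile j).evolve (-t j n) (x j n))‖ ≤ ε := fun h ε hε => by
    filter_upwards [h.eventually_norm_toL4_le hε, eventually_ge_atTop 1] with N h1 hN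
    filter_upwards [h1 hN] with n hn
    rwa [hdec h hN n, add_sub_cancel_left]
  have key := tendsto_norm_sq_bilinear_decomposition mulL4 norm_inner_mulL4_le
    (hprof h) (hprof h') (fun j k hjk => tendsto_mulL4_evolve (h.profile j) (h'.profile k) (by
      refine (h.orthogonality j k hjk).congr fun n => ?_
      rw [neg_sub_neg, abs_sub_comm]))
    (φ := fun n => toL4 (h.weaklyDiff n)) (φ' := fun n => toL4 (h'.weaklyDiff n))
    (fun N n => (add_sub_cancel _ _).symm) (fun N n => (add_sub_cancel _ _).symm)
    (hbd h) (hbd h') (hvan h) (hvan h') M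
  refine key.congr fun n => ?_
  rw [integral_norm_mul_sq (h.weaklyDiff n) (h'.weaklyDiff n),
    integral_norm_mul_sq (h.remainder M hM n) (h'.remainder M hM n),
    Finset.sum_congr rfl fun j _ => integral_norm_mul_sq ((h.profile j).evolve (-t j n) (x j n))
      ((h'.profile j).evolve (-t j n) (x j n)),
    hdec h hM n, hdec h' hM n, add_sub_cancel_left, add_sub_cancel_left]

theorem IsProfileDecomposition.singleDecomposition {r₀ : ℝ≥0∞} (hr₀ : 3 ≤ r₀)
    {φ φ' ψ ψ' : ℕ → L2} {t : ℕ → ℕ → ℝ} {x : ℕ → ℕ → E3} {W W' : ℕ → ℕ → L2}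
    (h : IsProfileDecomposition r₀ φ φ' ψ ψ' t x W W') : SingleDecomposition φ ψ t x W where
  weaklyDiff n := by
    obtain ⟨C, hC⟩ := h.bounded
    exact (hC n).1.weaklyDiff
  bounded := by
    obtain ⟨C, hC⟩ := h.bounded
    exact ⟨4 * C, fun n => (h1Size_le (φ n)).trans (by linarith [(hC n).2])⟩
  profile j := (h.profile_mem j).weaklyDiff
  remainder M hM n := (h.remainder_mem M hM n).weaklyDiff
  decomposition M hM n := by simpa only [profileWave_eq_evolve] using h.decomposition M hM n
  orthogonality := h.orthogonality
  vanishing ε hε := by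
    filter_upwards [h.vanishing.eventually_lt_const (ENNReal.ofReal_pos.2 hε)] with M hM
    filter_upwards [eventually_lt_of_limsup_lt hM] with n hn s y
    exact (eLpNorm_three_evolve_le hr₀ (W M n) s y).trans (le_self_add.trans hn.le)

theorem IsProfileDecomposition.symm {r₀ : ℝ≥0∞}
    {φ φ' ψ ψ' : ℕ → L2} {t : ℕ → ℕ → ℝ} {x : ℕ → ℕ → E3} {W W' : ℕ → ℕ → L2}
    (h : IsProfileDecomposition r₀ φ φ' ψ ψ' t x W W') :
    IsProfileDecomposition r₀ φ' φ ψ' ψ t x W' W where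
  bounded := h.bounded'
  bounded' := h.bounded
  profile_mem := h.profile_mem'
  profile_mem' := h.profile_mem
  remainder_mem := h.remainder_mem'
  remainder_mem' := h.remainder_mem
  decomposition := h.decomposition'
  decomposition' := h.decomposition
  orthogonality := h.orthogonality
  vanishing := by simpa only [add_comm] using h.vanishing

theorem SingleDecomposition.tendsto_sum_norm_sq {φ ψ : ℕ → L2} {t : ℕ → ℕ → ℝ}
    {x : ℕ → ℕ → E3} {W : ℕ → ℕ → L2} (h : SingleDecomposition φ ψ t x W) {M : ℕ} (hM : 1 ≤ M) :
    Tendsto (fun n => ∑ k, ‖weakPartial k (φ n)‖ ^ 2 - (∑ j ∈ Finset.range M,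
      ∑ k, ‖weakPartial k (evolve (-t j n) (x j n) (ψ j))‖ ^ 2 +
        ∑ k, ‖weakPartial k (W M n)‖ ^ 2)) atTop (𝓝 0) := by
  have h1 := tendsto_finsetSum Finset.univ fun k _ => h.tendsto_norm_sq_weakPartial hM k
  rw [Finset.sum_const_zero] at h1
  refine h1.congr fun n => ?_
  rw [Finset.sum_sub_distrib, Finset.sum_add_distrib, Finset.sum_comm]

end NLSSystem

end

open NLSSystem in
theorem proposition4p5 (β : ℝ) (hβ : 0 < β) (r₀ : ℝ≥0∞) (hr₀ : 3 < r₀) (hr₀' : r₀ < 6)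
    (φ φ' : ℕ → L2) (ψ ψ' : ℕ → L2) (t : ℕ → ℕ → ℝ) (x : ℕ → ℕ → E3) (W W' : ℕ → ℕ → L2)
    (h : IsProfileDecomposition r₀ φ φ' ψ ψ' t x W W') (M : ℕ) (hM : 1 ≤ M) :
    Tendsto (fun n => energy β (φ n) (φ' n) -
        (∑ j ∈ Finset.range M, energy β (profileWave (t j n) (x j n) (ψ j))
            (profileWave (t j n) (x j n) (ψ' j)) +
          energy β (W M n) (W' M n))) atTop (𝓝 0) ∧
    Tendsto (fun n => (∫ y : E3, ‖φ n y * φ' n y‖ ^ 2) -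
        (∑ j ∈ Finset.range M, (∫ y : E3, ‖profileWave (t j n) (x j n) (ψ j) y *
            profileWave (t j n) (x j n) (ψ' j) y‖ ^ 2) +
          ∫ y : E3, ‖W M n y * W' M n y‖ ^ 2)) atTop (𝓝 0) := by
  have h1 := h.singleDecomposition hr₀.le
  have h2 := h.symm.singleDecomposition hr₀.le
  have h12 := h1.tendsto_integral_norm_mul_sq h2 hM
  simp only [profileWave_eq_evolve]
  refine ⟨?_, h12⟩
  have h11 := h1.tendsto_integral_norm_mul_sq h1 hM
  have h22 := h2.tendsto_integral_norm_mul_sq h2 hM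
  have hlim := (((h1.tendsto_sum_norm_sq hM).add (h2.tendsto_sum_norm_sq hM)).const_mul
    (1 / 2)).sub (((h11.add (h12.const_mul (2 * β))).add h22).const_mul (1 / 4))
  simp only [mul_zero, add_zero, sub_zero] at hlim
  refine hlim.congr fun n => ?_
  rw [energy_eq β (h1.weaklyDiff n) (h2.weaklyDiff n),
    energy_eq β (h1.remainder M hM n) (h2.remainder M hM n),
    Finset.sum_congr rfl fun j _ => energy_eq β ((h1.profile j).evolve (-t j n) (x j n))
      ((h2.profile j).evolve (-t j n) (x j n))]
  simp only [Finset.sum_sub_distrib, Finset.sum_add_distrib, ← Finset.mul_sum]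
  ring
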